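/- Rings are unital and associative, not necessarily commutative. Let $$K\hookrightarrow C,\qquad K\hookrightarrow R,\qquad R\to A,\qquad C\to A$$ be ring homomorphisms forming a commutative square, the first two injective, such that the product of $A$ induces a bijection $R\otimes_K C\to A$, $r\otimes c\mapsto rc$. Assume: 1. $C=\bigoplus_{n\ge 0}C_n$ is homogeneous quadratic over $K$: $C_0=K$ and, with $W:=C_1$ and $I_C:=\ker(W\otimes_K W\to C_2)$, the canonical map $T_K(W)/\langle I_C\rangle\to C$ is an isomorphism; 2. $F_nA:=R\otimes_K(C_0\oplus\dots\oplus C_n)$ defines a filtration of the ring $A$, i.e. $F_mA\cdot F_nA\subset F_{m+n}A$; 3. each $C_n$ is a finitely generated projective left $K$-module. Let $\epsilon=\mathrm{id}_R\otimes\epsilon_C:A\cong R\otimes_KC\to R$, where $\epsilon_C:C\to C_0=K$ is the projection, and $V:=F_1A\cap\ker\epsilon\cong F_1A/F_0A$, an $R$-bimodule through this isomorphism. Put $q(v\otimes r):=\epsilon(vr)$ for $v\in V$, $r\in R$, and let $\hat q:R\to\operatorname{Hom}_R(V,R)$, $\hat q(r)(v)=q(v\otimes r)$, be its adjoint. Let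 $\mu:V\otimes_{\mathbb Z}V\to A$ be the product, $I_A:=\ker(V\otimes_RV\to F_2A/F_1A)$, and let $\widehat I\subset V\otimes_{\mathbb Z}V$ be the preimage of $I_A$, so that $\mu(\widehat I)\subset F_1A=R\oplus V$; let $h:\widehat I\to R$ (the curvature) and $p:\widehat I\to V$ be the two components of $\mu|_{\widehat I}$. Let $(\mathsf{gr}^FA)^\perp:=T_R(V^\vee)/\langle I_A^\perp\rangle$ be the quadratic dual, where $V^\vee=\operatorname{Hom}_R(V,R)$ and $I_A^\perp=\operatorname{Hom}_R((V\otimes_RV)/I_A,R)\subset V^\vee\otimes_RV^\vee$ via the pairing $\langle v\otimes u,f\otimes g\rangle=\langle v\langle u,f\rangle,g\rangle$. Let $C^\perp$ be the quadratic dual of $C$, defined in the same way over $K$ from $(K;W,I_C)$. Then: * $\epsilon$ is a left augmentation ($\ker\epsilon$ is a left ideal of $A$), and the curvature $h$ is zero. * $r\otimes w\mapsto rw$ is a bijection $R\otimes_KW\cong V$, and $\phi\otimes r\mapsto\tilde\phi\, r$ is a bijection $\operatorname{Hom}_K(W,K)\otimes_KR\cong\operatorname{Hom}_R(V,R)$,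 where $\tilde\phi(rw)=r\phi(w)$. The rings and modules $R$ and $\operatorname{Hom}_R(V,R)$ embed in $(\mathsf{gr}^FA)^\perp$. The maps $K\to R$ and $\phi\mapsto\tilde\phi$ induce a ring homomorphism $C^\perp\to(\mathsf{gr}^FA)^\perp$, and the product induces a bijection $C^\perp\otimes_KR\cong(\mathsf{gr}^FA)^\perp$. * Left $R$-linear sections of $\widehat I\to I_A$ exist, and there is exactly one additive map $d:(\mathsf{gr}^FA)^\perp\to(\mathsf{gr}^FA)^\perp$ (Positselski's differential) which makes $(\mathsf{gr}^FA)^\perp$ a DG ring (degree $+1$, $d(ab)=d(a)b+(-1)^{|a|}a\,d(b)$, $d^2=0$) and satisfies $\langle v,dr\rangle=q(v\otimes r)$ for $v\in V$, $r\in R$, and $$\langle i,d\phi\rangle=\langle p(s(i)),\phi\rangle-\tilde q(s(i)\otimes\phi),\qquad \tilde q(x\otimes y\otimes\phi)=q(x\otimes\langle y,\phi\rangle),$$ for $i\in I_A$, $\phi\in\operatorname{Hom}_R(V,R)$ and every left $R$-linear section $s$ of $\widehat I\to I_A$. * This $d$ satisfies $$d|_R=\hat q:R\to\operatorname{Hom}_R(V,R)\cong\operatorname{Hom}_K(W,K)\otimes_KR\subset(\mathsf{gr}^FA)^\perp,\qquad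 d|_{\operatorname{Hom}_K(W,K)}=0,$$ and it is the only differential making $(\mathsf{gr}^FA)^\perp$ a DG ring with these two restrictions. -/

import Mathlib

open scoped TensorProduct DirectSum
open MulOpposite

noncomputable section

/-! ## Tensor products over a noncommutative ring -/

/-- The additive map on `M ⊗ N` induced by a biadditive map. -/
def tensorLift {M N P : Type*} [AddCommGroup M] [AddCommGroup N] [AddCommGroup P]
    (f : M →+ N →+ P) : M ⊗[ℤ] N →+ P :=
  TensorProduct.liftAddHom f (by intro r m n; simp)

/-- The subgroup of `M ⊗[ℤ] N` generated by the elements `m k ⊗ n - m ⊗ k n`. -/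
def balancedRelations (K M N : Type*) [Ring K] [AddCommGroup M] [Module Kᵐᵒᵖ M]
    [AddCommGroup N] [Module K N] : AddSubgroup (M ⊗[ℤ] N) :=
  AddSubgroup.closure
    {t | ∃ (m : M) (k : K) (n : N), t = (op k • m) ⊗ₜ[ℤ] n - m ⊗ₜ[ℤ] (k • n)}

/-- The tensor product `M ⊗_K N` of a right `K`-module `M` and a left `K`-module `N` over a
not necessarily commutative ring `K`; right modules are modules over `Kᵐᵒᵖ`. -/
def BalTensor (K M N : Type*) [Ring K] [AddCommGroup M] [Module Kᵐᵒᵖ M]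
    [AddCommGroup N] [Module K N] : Type _ :=
  (M ⊗[ℤ] N) ⧸ balancedRelations K M N

namespace BalTensor

section basic
variable (K : Type*) {M N : Type*} [Ring K] [AddCommGroup M] [Module Kᵐᵒᵖ M]
  [AddCommGroup N] [Module K N]

instance instAddCommGroup : AddCommGroup (BalTensor K M N) :=
  inferInstanceAs (AddCommGroup ((M ⊗[ℤ] N) ⧸ balancedRelations K M N))

/-- The canonical surjection `M ⊗ N → M ⊗_K N`. -/
def proj : M ⊗[ℤ] N →+ BalTensor K M N :=
  QuotientAddGroup.mk' (balancedRelations K M N)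

theorem proj_surjective : Function.Surjective (proj K : M ⊗[ℤ] N →+ BalTensor K M N) :=
  QuotientAddGroup.mk'_surjective (balancedRelations K M N)

/-- The class of `m ⊗ n` in `M ⊗_K N`. -/
def tmul (m : M) (n : N) : BalTensor K M N := proj K (m ⊗ₜ[ℤ] n)

/-- A biadditive map which is balanced over `K` induces an additive map on `M ⊗_K N`. -/
def lift {P : Type*} [AddCommGroup P] (f : M →+ N →+ P)
    (hf : ∀ (m : M) (k : K) (n : N), f (op k • m) n = f m (k • n)) : BalTensor K M N →+ P :=
  QuotientAddGroup.lift (balancedRelations K M N)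
    (tensorLift f) (by
      rw [balancedRelations, AddSubgroup.closure_le]
      rintro _ ⟨m, k, n, rfl⟩
      simp [tensorLift, hf])

@[simp] theorem lift_tmul {P : Type*} [AddCommGroup P] (f : M →+ N →+ P)
    (hf : ∀ (m : M) (k : K) (n : N), f (op k • m) n = f m (k • n)) (m : M) (n : N) :
    lift K f hf (tmul K m n) = f m n := rfl

@[elab_as_elim]
theorem induction_on {p : BalTensor K M N → Prop} (t : BalTensor K M N) (h0 : p 0)
    (ht : ∀ m n, p (tmul K m n)) (ha : ∀ x y, p x → p y → p (x + y)) : p t := by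
  obtain ⟨t, rfl⟩ := proj_surjective K t
  induction t with
  | zero => simpa using h0
  | tmul m n => exact ht m n
  | add x y hx hy => rw [map_add]; exact ha _ _ hx hy

theorem balanced (m : M) (k : K) (n : N) : tmul K (op k • m) n = tmul K m (k • n) := by
  refine QuotientAddGroup.eq_iff_sub_mem.2 ?_
  exact AddSubgroup.subset_closure ⟨m, k, n, rfl⟩

end basic

section leftModule
variable (K : Type*) {M N S : Type*} [Ring K] [AddCommGroup M] [Module Kᵐᵒᵖ M]
  [AddCommGroup N] [Module K N] [Ring S] [Module S M] [SMulCommClass S Kᵐᵒᵖ M]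

/-- A left action of `S` on `M` which commutes with the right action of `K` induces a left
action of `S` on `M ⊗_K N`. -/
def smulHom (s : S) : BalTensor K M N →+ BalTensor K M N :=
  QuotientAddGroup.map (balancedRelations K M N) (balancedRelations K M N)
    (DistribSMul.toAddMonoidHom (M ⊗[ℤ] N) s) (by
      rw [balancedRelations, AddSubgroup.closure_le]
      rintro _ ⟨m, k, n, rfl⟩
      refine AddSubgroup.subset_closure ⟨s • m, k, n, ?_⟩
      simp [smul_sub, TensorProduct.smul_tmul', smul_comm s (op k) m])

instance instModule : Module S (BalTensor K M N) where
  smul s t := smulHom K s t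
  one_smul t := by
    change smulHom K (1 : S) t = t
    refine induction_on K t (by simp) (fun m n => ?_) (fun x y hx hy => ?_)
    · exact congrArg (fun z => tmul K z n) (one_smul S m)
    · simp only [map_add, hx, hy]
  mul_smul r s t := by
    change smulHom K (r * s) t = smulHom K r (smulHom K s t)
    refine induction_on K t (by simp) (fun m n => ?_) (fun x y hx hy => ?_)
    · exact congrArg (fun z => tmul K z n) (mul_smul r s m)
    · simp only [map_add, hx, hy]
  smul_zero s := map_zero (smulHom K s)
  smul_add s := map_add (smulHom K s)
  add_smul r s t := by
    change smulHom K (r + s) t = smulHom K r t + smulHom K s t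
    refine induction_on K t (by simp) (fun m n => ?_) (fun x y hx hy => ?_)
    · change proj K (((r + s) • m) ⊗ₜ[ℤ] n) =
        proj K ((r • m) ⊗ₜ[ℤ] n) + proj K ((s • m) ⊗ₜ[ℤ] n)
      rw [add_smul, TensorProduct.add_tmul, map_add]
    · simp only [map_add, hx, hy]; abel
  zero_smul t := by
    change smulHom K (0 : S) t = 0
    refine induction_on K t (by simp) (fun m n => ?_) (fun x y hx hy => ?_)
    · change proj K (((0 : S) • m) ⊗ₜ[ℤ] n) = 0
      rw [zero_smul, TensorProduct.zero_tmul, map_zero]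
    · simp only [map_add, hx, hy, add_zero]

@[simp] theorem smul_tmul (s : S) (m : M) (n : N) : s • tmul K m n = tmul K (s • m) n := rfl

/-- The canonical surjection `M ⊗ N → M ⊗_K N` as a map of left `S`-modules. -/
def projₗ : M ⊗[ℤ] N →ₗ[S] BalTensor K M N where
  toFun := proj K
  map_add' := map_add _
  map_smul' s t := by
    induction t with
    | zero => simp
    | tmul m n => rfl
    | add x y hx hy => simp only [smul_add, map_add, hx, hy]

end leftModule

end BalTensor

/-! ## Left duals of bimodules -/

section leftDual
variable (R V : Type*) [Ring R] [AddCommGroup V] [Module R V]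

/-- The left dual `Hom_R(V, R)`. -/
def LeftDual : Type _ := V →ₗ[R] R

instance : AddCommGroup (LeftDual R V) := inferInstanceAs (AddCommGroup (V →ₗ[R] R))

instance : FunLike (LeftDual R V) V R := inferInstanceAs (FunLike (V →ₗ[R] R) V R)

instance : AddMonoidHomClass (LeftDual R V) V R :=
  inferInstanceAs (AddMonoidHomClass (V →ₗ[R] R) V R)

/-- The right action `⟨v, f r⟩ = ⟨v, f⟩ r`. -/
instance : Module Rᵐᵒᵖ (LeftDual R V) := inferInstanceAs (Module Rᵐᵒᵖ (V →ₗ[R] R))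

variable {R V}

namespace LeftDual

@[ext] theorem ext {f g : LeftDual R V} (h : ∀ v, f v = g v) : f = g := LinearMap.ext h

theorem map_smul (f : LeftDual R V) (r : R) (v : V) : f (r • v) = r * f v :=
  LinearMap.map_smul f r v

@[simp] theorem add_apply (f g : LeftDual R V) (v : V) : (f + g) v = f v + g v := rfl

@[simp] theorem zero_apply (v : V) : (0 : LeftDual R V) v = 0 := rfl

@[simp] theorem op_smul_apply (r : R) (f : LeftDual R V) (v : V) : (op r • f) v = f v * r := rfl

variable [Module Rᵐᵒᵖ V]

/-- The functional `v ⊗ u ↦ ⟨v ⟨u, f⟩, g⟩` on `V ⊗_R V`. -/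
def pairingAux (f g : LeftDual R V) : BalTensor R V V →+ R :=
  BalTensor.lift R
    (AddMonoidHom.mk' (fun v => AddMonoidHom.mk' (fun u => g (op (f u) • v))
        (fun u u' => by rw [map_add, op_add, add_smul, map_add]))
      (fun v v' => AddMonoidHom.ext fun u => by
        change g (op (f u) • (v + v')) = g (op (f u) • v) + g (op (f u) • v')
        rw [smul_add, map_add]))
    (fun v r u => by
      change g (op (f u) • op r • v) = g (op (f (r • u)) • v)
      rw [map_smul, op_mul, mul_smul])

theorem pairingAux_add_left (f f' g : LeftDual R V) :
    pairingAux (f + f') g = pairingAux f g + pairingAux f' g := by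
  refine AddMonoidHom.ext fun t => ?_
  induction t using BalTensor.induction_on with
  | h0 => simp
  | ht v u =>
    change g (op (f u + f' u) • v) = g (op (f u) • v) + g (op (f' u) • v)
    rw [op_add, add_smul, map_add]
  | ha x y hx hy => rw [map_add, map_add, hx, hy]

theorem pairingAux_add_right (f g g' : LeftDual R V) :
    pairingAux f (g + g') = pairingAux f g + pairingAux f g' := by
  refine AddMonoidHom.ext fun t => ?_
  induction t using BalTensor.induction_on with
  | h0 => simp
  | ht v u => rfl
  | ha x y hx hy => rw [map_add, map_add, hx, hy]

variable [SMulCommClass R Rᵐᵒᵖ V]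

/-- The left action `⟨v, r f⟩ = ⟨v r, f⟩` on the left dual of an `R`-bimodule. -/
instance : Module R (LeftDual R V) where
  smul r f := (LinearMap.comp f (⟨⟨fun v => op r • v, fun x y => smul_add _ x y⟩,
    fun s v => (smul_comm s (op r) v).symm⟩ : V →ₗ[R] V) : V →ₗ[R] R)
  one_smul f := ext fun v => congrArg f (one_smul Rᵐᵒᵖ v)
  mul_smul r s f := ext fun v => congrArg f (mul_smul (op s) (op r) v)
  smul_zero _ := rfl
  smul_add _ _ _ := rfl
  add_smul r s f := ext fun v =>
    (congrArg f (add_smul (op r) (op s) v)).trans (map_add f _ _)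
  zero_smul f := ext fun v => (congrArg f (zero_smul Rᵐᵒᵖ v)).trans (map_zero f)

@[simp] theorem smul_apply (r : R) (f : LeftDual R V) (v : V) : (r • f) v = f (op r • v) := rfl

theorem pairingAux_balanced (f : LeftDual R V) (r : R) (g : LeftDual R V) :
    pairingAux (op r • f) g = pairingAux f (r • g) := by
  refine AddMonoidHom.ext fun t => ?_
  induction t using BalTensor.induction_on with
  | h0 => simp
  | ht v u =>
    change g (op (f u * r) • v) = g (op r • op (f u) • v)
    rw [op_mul, mul_smul]
  | ha x y hx hy => rw [map_add, map_add, hx, hy]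

/-- The pairing of `V ⊗_R V` with `Hom_R(V, R) ⊗_R Hom_R(V, R)`, given by
`⟨v ⊗ u, f ⊗ g⟩ = ⟨v ⟨u, f⟩, g⟩`. -/
def pairing : BalTensor R (LeftDual R V) (LeftDual R V) →+ BalTensor R V V →+ R :=
  BalTensor.lift R
    (AddMonoidHom.mk' (fun f => AddMonoidHom.mk' (pairingAux f) (pairingAux_add_right f))
      (fun f f' => AddMonoidHom.ext fun g => pairingAux_add_left f f' g))
    pairingAux_balanced

theorem pairing_tmul (f g : LeftDual R V) (v u : V) :
    pairing (BalTensor.tmul R f g) (BalTensor.tmul R v u) = g (op (f u) • v) := rfl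

/-- For a subgroup `I` of `V ⊗_R V`, the elements of `Hom_R(V, R) ⊗_R Hom_R(V, R)` which vanish
on `I`; for `V` finitely generated projective this is `Hom_R((V ⊗_R V) / I, R)`. -/
def annihilator (I : AddSubgroup (BalTensor R V V)) :
    AddSubgroup (BalTensor R (LeftDual R V) (LeftDual R V)) where
  carrier := {t | ∀ i ∈ I, pairing t i = 0}
  zero_mem' := fun i _ => by simp
  add_mem' := fun {a b} ha hb i hi => by simp [ha i hi, hb i hi]
  neg_mem' := fun {a} ha i hi => by simp [ha i hi]

end LeftDual

end leftDual

/-! ## Homogeneous quadratic rings -/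

section quadratic
variable (R V : Type*) [Ring R] [AddCommGroup V] [Module R V] [Module Rᵐᵒᵖ V]

/-- The relations of the tensor ring of the `R`-bimodule `V`, on generators `R` and `V`. -/
inductive TensorRing.Rel : FreeAlgebra ℤ (R ⊕ V) → FreeAlgebra ℤ (R ⊕ V) → Prop
  | one : Rel (FreeAlgebra.ι ℤ (Sum.inl 1)) 1
  | mul (r s : R) : Rel (FreeAlgebra.ι ℤ (Sum.inl (r * s)))
      (FreeAlgebra.ι ℤ (Sum.inl r) * FreeAlgebra.ι ℤ (Sum.inl s))
  | add (r s : R) : Rel (FreeAlgebra.ι ℤ (Sum.inl (r + s)))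
      (FreeAlgebra.ι ℤ (Sum.inl r) + FreeAlgebra.ι ℤ (Sum.inl s))
  | gen_add (v w : V) : Rel (FreeAlgebra.ι ℤ (Sum.inr (v + w)))
      (FreeAlgebra.ι ℤ (Sum.inr v) + FreeAlgebra.ι ℤ (Sum.inr w))
  | smul (r : R) (v : V) : Rel (FreeAlgebra.ι ℤ (Sum.inr (r • v)))
      (FreeAlgebra.ι ℤ (Sum.inl r) * FreeAlgebra.ι ℤ (Sum.inr v))
  | op_smul (r : R) (v : V) : Rel (FreeAlgebra.ι ℤ (Sum.inr (op r • v)))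
      (FreeAlgebra.ι ℤ (Sum.inr v) * FreeAlgebra.ι ℤ (Sum.inl r))

/-- The tensor ring `T_R(V)`: the universal ring with a ring homomorphism from `R` and an
`R`-bimodule homomorphism from `V`. -/
def TensorRing : Type _ := RingQuot (TensorRing.Rel R V)

instance : Ring (TensorRing R V) := inferInstanceAs (Ring (RingQuot (TensorRing.Rel R V)))

namespace TensorRing

variable {R V}

/-- The quotient map from the free ring. -/
def mk : FreeAlgebra ℤ (R ⊕ V) →+* TensorRing R V := RingQuot.mkRingHom (Rel R V)

theorem mk_rel {x y} (h : Rel R V x y) : mk x = mk y := RingQuot.mkRingHom_rel h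

variable (R V)

/-- The structure map `R → T_R(V)`. -/
def base : R →+* TensorRing R V :=
  RingHom.mk' ⟨⟨fun r => mk (FreeAlgebra.ι ℤ (Sum.inl r)),
      (mk_rel Rel.one).trans (map_one _)⟩,
    fun r s => (mk_rel (Rel.mul r s)).trans (map_mul _ _ _)⟩
    (fun r s => (mk_rel (Rel.add r s)).trans (map_add _ _ _))

/-- The inclusion of generators `V → T_R(V)`. -/
def gen : V →+ TensorRing R V :=
  AddMonoidHom.mk' (fun v => mk (FreeAlgebra.ι ℤ (Sum.inr v)))
    (fun v w => (mk_rel (Rel.gen_add v w)).trans (map_add _ _ _))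

variable {R V}

theorem gen_smul (r : R) (v : V) : gen R V (r • v) = base R V r * gen R V v :=
  (mk_rel (Rel.smul r v)).trans (map_mul _ _ _)

theorem gen_op_smul (r : R) (v : V) : gen R V (op r • v) = gen R V v * base R V r :=
  (mk_rel (Rel.op_smul r v)).trans (map_mul _ _ _)

variable (R V)

/-- The map `V ⊗_R V → T_R(V)`. -/
def gen₂ : BalTensor R V V →+ TensorRing R V :=
  BalTensor.lift R (AddMonoidHom.mk' (fun v => (AddMonoidHom.mulLeft (gen R V v)).comp (gen R V))
      (fun v w => by ext u; simp [add_mul]))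
    (fun v r w => by
      change gen R V (op r • v) * gen R V w = gen R V v * gen R V (r • w)
      rw [gen_op_smul, gen_smul, mul_assoc])

end TensorRing

variable (I : AddSubgroup (BalTensor R V V))

/-- The homogeneous quadratic ring `T_R(V) / ⟨I⟩` of the quadratic datum `(R; V, I)`. -/
def QuadraticRing : Type _ :=
  RingQuot (fun x y : TensorRing R V => ∃ t ∈ I, x = TensorRing.gen₂ R V t ∧ y = 0)

instance : Ring (QuadraticRing R V I) := inferInstanceAs (Ring (RingQuot _))

namespace QuadraticRing

/-- The quotient map `T_R(V) → T_R(V) / ⟨I⟩`. -/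
def mk : TensorRing R V →+* QuadraticRing R V I := RingQuot.mkRingHom _

/-- The structure map `R → T_R(V) / ⟨I⟩`. -/
def base : R →+* QuadraticRing R V I := (mk R V I).comp (TensorRing.base R V)

/-- The map `V → T_R(V) / ⟨I⟩`. -/
def gen : V →+ QuadraticRing R V I := (mk R V I).toAddMonoidHom.comp (TensorRing.gen R V)

/-- The map `V ⊗_R V → T_R(V) / ⟨I⟩`. -/
def gen₂ : BalTensor R V V →+ QuadraticRing R V I :=
  (mk R V I).toAddMonoidHom.comp (TensorRing.gen₂ R V)

/-- The component of degree `n`: the subgroup generated by the products `v₁ ⋯ vₙ r`. -/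
def grade : ℕ → AddSubgroup (QuadraticRing R V I)
  | 0 => (base R V I).range.toAddSubgroup
  | n + 1 => AddSubgroup.closure {x | ∃ (v : V), ∃ b ∈ grade n, x = gen R V I v * b}

instance : Module Rᵐᵒᵖ (QuadraticRing R V I) :=
  Module.compHom (QuadraticRing R V I) (RingHom.op (base R V I))

end QuadraticRing

end quadratic

/-! ## Differential graded rings -/

/-- `(B, 𝒢, d)` is a differential graded ring: `B` is the direct sum of the components `𝒢 n`,
these are multiplicative, and `d` is an odd derivation of degree one and square zero. -/
structure IsDGRing {B : Type*} [Ring B] (𝒢 : ℕ → AddSubgroup B) (d : B →+ B) : Prop where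
  gradedMonoid : SetLike.GradedMonoid 𝒢
  isInternal : DirectSum.IsInternal 𝒢
  map_mem : ∀ n, ∀ b ∈ 𝒢 n, d b ∈ 𝒢 (n + 1)
  leibniz : ∀ n, ∀ a ∈ 𝒢 n, ∀ b, d (a * b) = d a * b + (-1) ^ n * (a * d b)
  sq_zero : ∀ b, d (d b) = 0

/-! ## Filtered rings with a left linear splitting -/

/-- A filtered ring `(A, F)` with `F₀ A = R`, together with a left `R`-linear retraction
`eps : A → R` of the unit `iota : R → A`. It is a left augmentation if moreover the kernel of
`eps` is a left ideal, see `IsLeftAugmentation`. -/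
structure SplitFilteredRing (R A : Type*) [Ring R] [Ring A] where
  iota : R →+* A
  F : ℕ → AddSubgroup A
  F_zero : F 0 = iota.range.toAddSubgroup
  F_mono : Monotone F
  F_exhaustive : ∀ a, ∃ n, a ∈ F n
  F_mul : ∀ {m n : ℕ} {a b : A}, a ∈ F m → b ∈ F n → a * b ∈ F (m + n)
  eps : A →+ R
  eps_mul : ∀ r a, eps (iota r * a) = r * eps a
  eps_iota : ∀ r, eps (iota r) = r

namespace SplitFilteredRing

variable {R A : Type*} [Ring R] [Ring A] (T : SplitFilteredRing R A)

/-- The kernel of `eps` is a left ideal. -/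
def IsLeftAugmentation : Prop := ∀ a x, T.eps x = 0 → T.eps (a * x) = 0

theorem iota_mem (r : R) : T.iota r ∈ T.F 0 := by
  rw [T.F_zero]; exact ⟨r, rfl⟩

theorem mem_one_of_mem_zero {a : A} (h : a ∈ T.F 0) : a ∈ T.F 1 := T.F_mono (Nat.zero_le 1) h

theorem iota_mul_mem {r : R} {a : A} {n : ℕ} (h : a ∈ T.F n) : T.iota r * a ∈ T.F n := by
  simpa using T.F_mul (T.iota_mem r) h

theorem mul_iota_mem {r : R} {a : A} {n : ℕ} (h : a ∈ T.F n) : a * T.iota r ∈ T.F n :=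
  T.F_mul h (T.iota_mem r)

/-- The subgroup `V = F₁ A ∩ ker eps` of `A`, which maps isomorphically to `F₁ A / F₀ A`. -/
def genSubgroup : AddSubgroup A := T.F 1 ⊓ T.eps.ker

/-- The `R`-bimodule `V ≅ F₁ A / F₀ A`, realised as `F₁ A ∩ ker eps`. -/
def Gen : Type _ := T.genSubgroup

namespace Gen

instance : AddCommGroup T.Gen := inferInstanceAs (AddCommGroup T.genSubgroup)

variable {T}

/-- The inclusion `V → A`. -/
def val : T.Gen →+ A := T.genSubgroup.subtype

theorem val_injective : Function.Injective (val : T.Gen →+ A) := Subtype.val_injective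

theorem val_mem (v : T.Gen) : val v ∈ T.F 1 := v.2.1

@[simp] theorem eps_val (v : T.Gen) : T.eps (val v) = 0 := v.2.2

/-- The left action of `R` on `V` is the multiplication of `A`. -/
instance : Module R T.Gen where
  smul r v := ⟨T.iota r * val v, T.iota_mul_mem v.val_mem, by
    change T.eps _ = 0; rw [T.eps_mul, eps_val, mul_zero]⟩
  one_smul v := val_injective (by
    change T.iota 1 * val v = val v; rw [map_one, one_mul])
  mul_smul r s v := val_injective (by
    change T.iota (r * s) * val v = T.iota r * (T.iota s * val v); rw [map_mul, mul_assoc])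
  smul_zero r := val_injective (by
    change T.iota r * 0 = 0; rw [mul_zero])
  smul_add r v w := val_injective (by
    change T.iota r * (val v + val w) = T.iota r * val v + T.iota r * val w; rw [mul_add])
  add_smul r s v := val_injective (by
    change T.iota (r + s) * val v = T.iota r * val v + T.iota s * val v
    rw [map_add, add_mul])
  zero_smul v := val_injective (by
    change T.iota 0 * val v = 0; rw [map_zero, zero_mul])

theorem val_smul (r : R) (v : T.Gen) : val (r • v) = T.iota r * val v := rfl

/-- The right action of `R` on `V` is the right action on `F₁ A / F₀ A`: the component in `V` of
the product `v r` formed in `A`. -/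
instance : Module Rᵐᵒᵖ T.Gen where
  smul r v := ⟨val v * T.iota r.unop - T.iota (T.eps (val v * T.iota r.unop)),
    (T.F 1).sub_mem (T.mul_iota_mem v.val_mem) (T.mem_one_of_mem_zero (T.iota_mem _)), by
      change T.eps _ = 0; rw [map_sub, T.eps_iota, sub_self]⟩
  one_smul v := val_injective (by
    change val v * T.iota 1 - T.iota (T.eps (val v * T.iota 1)) = val v
    rw [map_one, mul_one, eps_val, map_zero, sub_zero])
  mul_smul r s v := val_injective (by
    change val v * T.iota (s.unop * r.unop) - T.iota (T.eps (val v * T.iota (s.unop * r.unop))) =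
      (val v * T.iota s.unop - T.iota (T.eps (val v * T.iota s.unop))) * T.iota r.unop -
      T.iota (T.eps ((val v * T.iota s.unop - T.iota (T.eps (val v * T.iota s.unop))) *
        T.iota r.unop))
    rw [sub_mul, ← map_mul T.iota (T.eps _), map_sub, T.eps_iota, map_sub, mul_assoc, ← map_mul]
    abel)
  smul_zero r := val_injective (by
    change 0 * T.iota r.unop - T.iota (T.eps (0 * T.iota r.unop)) = 0
    simp)
  smul_add r v w := val_injective (by
    change (val v + val w) * T.iota r.unop - T.iota (T.eps ((val v + val w) * T.iota r.unop)) =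
      (val v * T.iota r.unop - T.iota (T.eps (val v * T.iota r.unop))) +
      (val w * T.iota r.unop - T.iota (T.eps (val w * T.iota r.unop)))
    rw [add_mul, map_add, map_add]; abel)
  add_smul r s v := val_injective (by
    change val v * T.iota (r.unop + s.unop) - T.iota (T.eps (val v * T.iota (r.unop + s.unop))) =
      (val v * T.iota r.unop - T.iota (T.eps (val v * T.iota r.unop))) +
      (val v * T.iota s.unop - T.iota (T.eps (val v * T.iota s.unop)))
    rw [map_add T.iota, mul_add, map_add, map_add]; abel)
  zero_smul v := val_injective (by
    change val v * T.iota 0 - T.iota (T.eps (val v * T.iota 0)) = 0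
    simp)

theorem val_op_smul (r : R) (v : T.Gen) :
    val (op r • v) = val v * T.iota r - T.iota (T.eps (val v * T.iota r)) := rfl

instance : SMulCommClass R Rᵐᵒᵖ T.Gen where
  smul_comm r s v := val_injective (by
    change T.iota r * (val v * T.iota s.unop - T.iota (T.eps (val v * T.iota s.unop))) =
      T.iota r * val v * T.iota s.unop - T.iota (T.eps (T.iota r * val v * T.iota s.unop))
    rw [mul_sub, mul_assoc, T.eps_mul, map_mul T.iota])

end Gen

/-- `q(v ⊗ r)`: the component in `R` of the product `v r`. -/
def q (v : T.Gen) (r : R) : R := T.eps (v.val * T.iota r)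

/-- The adjoint `R → Hom_R(V, R)` of `q`. -/
def qhat (r : R) : LeftDual R T.Gen :=
  (⟨⟨fun v => T.q v r, fun v w => by simp [q, add_mul]⟩, fun s v => by
    change T.eps (T.iota s * v.val * T.iota r) = s * T.eps (v.val * T.iota r)
    rw [mul_assoc, T.eps_mul]⟩ : T.Gen →ₗ[R] R)

/-- The product `V ⊗ V → A`. -/
def mu : T.Gen ⊗[ℤ] T.Gen →+ A :=
  tensorLift
    (AddMonoidHom.mk' (fun v => (AddMonoidHom.mulLeft v.val).comp Gen.val)
      (fun v w => by ext u; simp [add_mul]))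

theorem mu_smul (r : R) (t : T.Gen ⊗[ℤ] T.Gen) : T.mu (r • t) = T.iota r * T.mu t := by
  induction t with
  | zero => simp
  | tmul v w => exact mul_assoc _ _ _
  | add x y hx hy => rw [smul_add, map_add, map_add, hx, hy, mul_add]

/-- The product `V ⊗_R V → F₂ A / F₁ A` of the associated graded ring, with values in
`A / F₁ A`. -/
def grMul : BalTensor R T.Gen T.Gen →+ A ⧸ T.F 1 :=
  BalTensor.lift R
    (AddMonoidHom.mk' (fun v => (QuotientAddGroup.mk' (T.F 1)).comp
        ((AddMonoidHom.mulLeft v.val).comp Gen.val))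
      (fun v w => by ext u; simp [add_mul]))
    (fun v r w => by
      refine QuotientAddGroup.eq_iff_sub_mem.2 ?_
      change (v.val * T.iota r - T.iota (T.eps (v.val * T.iota r))) * w.val -
        v.val * (T.iota r * w.val) ∈ T.F 1
      rw [sub_mul, mul_assoc, sub_sub_cancel_left]
      exact neg_mem (T.iota_mul_mem w.val_mem))

theorem grMul_proj (t : T.Gen ⊗[ℤ] T.Gen) :
    T.grMul (BalTensor.proj R t) = QuotientAddGroup.mk' (T.F 1) (T.mu t) := by
  induction t with
  | zero => simp
  | tmul v w => rfl
  | add x y hx hy => rw [map_add, map_add, map_add, map_add, hx, hy]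

theorem grMul_proj_eq_zero (t : T.Gen ⊗[ℤ] T.Gen) :
    T.grMul (BalTensor.proj R t) = 0 ↔ T.mu t ∈ T.F 1 := by
  rw [grMul_proj]; exact QuotientAddGroup.eq_zero_iff _

/-- The quadratic relations `I_A ⊂ V ⊗_R V` of the associated graded ring. -/
def relations : Submodule R (BalTensor R T.Gen T.Gen) where
  carrier := {t | T.grMul t = 0}
  zero_mem' := map_zero _
  add_mem' := fun {a b} (ha : T.grMul a = 0) (hb : T.grMul b = 0) => by
    change T.grMul (a + b) = 0; rw [map_add, ha, hb, add_zero]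
  smul_mem' := fun r t (ht : T.grMul t = 0) => by
    obtain ⟨t, rfl⟩ := BalTensor.proj_surjective R t
    rw [grMul_proj_eq_zero] at ht
    refine (T.grMul_proj_eq_zero (r • t)).2 ?_
    rw [mu_smul]; exact T.iota_mul_mem ht

/-- The preimage `Î ⊂ V ⊗ V` of `I_A`. -/
def liftedRelations : Submodule R (T.Gen ⊗[ℤ] T.Gen) :=
  T.relations.comap (BalTensor.projₗ R)

theorem mu_mem (t : T.liftedRelations) : T.mu t ∈ T.F 1 := (T.grMul_proj_eq_zero _).1 t.2

/-- The surjection `Î → I_A`. -/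
def toRelations : T.liftedRelations →ₗ[R] T.relations :=
  (BalTensor.projₗ R).restrict fun _ h => h

/-- The curvature map `Î → R`: the component in `R` of the product `Î → F₁ A = R ⊕ V`. -/
def curvature (t : T.liftedRelations) : R := T.eps (T.mu t)

/-- The map `p : Î → V`: the component in `V` of the product `Î → F₁ A = R ⊕ V`. -/
def p (t : T.liftedRelations) : T.Gen :=
  ⟨T.mu t - T.iota (T.curvature t),
    (T.F 1).sub_mem (T.mu_mem t) (T.mem_one_of_mem_zero (T.iota_mem _)), by
      change T.eps _ = 0; rw [map_sub, T.eps_iota]; exact sub_self _⟩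

/-- The map `q̃(x ⊗ y ⊗ φ) = q(x ⊗ ⟨y, φ⟩)`. -/
def qtilde (φ : LeftDual R T.Gen) : T.Gen ⊗[ℤ] T.Gen →+ R :=
  tensorLift
    (AddMonoidHom.mk' (fun x => AddMonoidHom.mk' (fun y => T.q x (φ y))
        (fun y y' => by simp [q, mul_add]))
      (fun x x' => by ext y; simp [q, add_mul]))

/-- The relations of the quadratic dual `(gr^F A)^⊥`. -/
def dualRelations : AddSubgroup (BalTensor R (LeftDual R T.Gen) (LeftDual R T.Gen)) :=
  LeftDual.annihilator T.relations.toAddSubgroup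

/-- The quadratic dual `(gr^F A)^⊥`, i.e. the homogeneous quadratic ring over `R` of the left dual
of the quadratic datum `(R; V, I_A)`. -/
abbrev Dual : Type _ := QuadraticRing R (LeftDual R T.Gen) T.dualRelations

/-- The inclusion of `R` as the degree zero component of `(gr^F A)^⊥`. -/
abbrev dualBase : R →+* T.Dual := QuadraticRing.base R (LeftDual R T.Gen) T.dualRelations

/-- The inclusion of `Hom_R(V, R)` as the degree one component of `(gr^F A)^⊥`. -/
abbrev dualGen : LeftDual R T.Gen →+ T.Dual :=
  QuadraticRing.gen R (LeftDual R T.Gen) T.dualRelations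

/-- The grading of `(gr^F A)^⊥`. -/
abbrev dualGrade : ℕ → AddSubgroup T.Dual :=
  QuadraticRing.grade R (LeftDual R T.Gen) T.dualRelations

/-- The left `R`-linear sections of `Î → I_A`. -/
def Section : Type _ :=
  {s : T.relations →ₗ[R] T.liftedRelations // T.toRelations ∘ₗ s = LinearMap.id}

/-- `⟨i, b⟩ = f i` for all `i ∈ I_A`, where `b` is an element of the degree two component
`(V^∨ ⊗_R V^∨) / I_A^⊥` of `(gr^F A)^⊥`: the pairing is computed on a representative `t` of `b`,
and it does not depend on `t` since `I_A^⊥` vanishes on `I_A`. -/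
def PairsTo (b : T.Dual) (f : T.relations → R) : Prop :=
  ∃ t : BalTensor R (LeftDual R T.Gen) (LeftDual R T.Gen),
    QuadraticRing.gen₂ R (LeftDual R T.Gen) T.dualRelations t = b ∧
      ∀ i : T.relations, LeftDual.pairing t i = f i

/-- `d` is Positselski's differential on `(gr^F A)^⊥`: it makes `(gr^F A)^⊥` into a DG ring,
`⟨v, d r⟩ = q(v ⊗ r)` for `r ∈ R`, and
`⟨i, d φ⟩ = ⟨p (s i), φ⟩ - q̃(s i ⊗ φ)` for `φ ∈ Hom_R(V, R)`, `i ∈ I_A` and any left `R`-linear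
section `s` of `Î → I_A`. -/
structure IsPositselskiDifferential (d : T.Dual →+ T.Dual) : Prop where
  isDGRing : IsDGRing T.dualGrade d
  base : ∀ r : R, ∃ α : LeftDual R T.Gen,
    d (T.dualBase r) = T.dualGen α ∧ ∀ v, α v = T.q v r
  gen : ∀ (s : T.Section) (φ : LeftDual R T.Gen),
    T.PairsTo (d (T.dualGen φ)) fun i => φ (T.p (s.1 i)) - T.qtilde φ (s.1 i)

end SplitFilteredRing

/-! ## Rings of the form `R ⊗_K C` -/

/-- A commutative square of unital rings
`K → C`, `K → R`, `R → A`, `C → A`, with `K → C` and `K → R` injective, together with a grading of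
the ring `C` by `ℕ` whose degree zero component is `K`. -/
structure GradedSquare where
  K : Type*
  R : Type*
  C : Type*
  A : Type*
  [ringK : Ring K]
  [ringR : Ring R]
  [ringC : Ring C]
  [ringA : Ring A]
  etaR : K →+* R
  etaC : K →+* C
  iota : R →+* A
  kappa : C →+* A
  comm : ∀ k, iota (etaR k) = kappa (etaC k)
  etaR_injective : Function.Injective etaR
  etaC_injective : Function.Injective etaC
  gr : ℕ → AddSubgroup C
  [graded : GradedRing gr]
  gr_zero : gr 0 = etaC.range.toAddSubgroup

namespace GradedSquare

attribute [instance] ringK ringR ringC ringA graded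

variable (S : GradedSquare)

instance : Module S.K S.C := Module.compHom S.C S.etaC
instance : Module S.K S.R := Module.compHom S.R S.etaR
instance : Module S.Kᵐᵒᵖ S.R := Module.compHom S.R (RingHom.op S.etaR)

theorem smul_C (k : S.K) (c : S.C) : k • c = S.etaC k * c := rfl
theorem smul_R (k : S.K) (r : S.R) : k • r = S.etaR k * r := rfl
theorem op_smul_R (k : S.K) (r : S.R) : op k • r = r * S.etaR k := rfl

instance : SMulCommClass S.R S.Kᵐᵒᵖ S.R where
  smul_comm r k s := (mul_assoc r s (S.etaR k.unop)).symm

theorem etaC_mem (k : S.K) : S.etaC k ∈ S.gr 0 := by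
  rw [S.gr_zero]; exact ⟨k, rfl⟩

/-- The component `C_n` as a left `K`-module. -/
def comp (n : ℕ) : Submodule S.K S.C where
  carrier := S.gr n
  zero_mem' := zero_mem _
  add_mem' := add_mem
  smul_mem' k c hc := by
    have h := SetLike.GradedMul.mul_mem (S.etaC_mem k) hc
    rwa [zero_add] at h

/-- The `K`-bimodule `W = C_1`. -/
def W : Type _ := S.comp 1

instance : AddCommGroup S.W := inferInstanceAs (AddCommGroup (S.comp 1))
instance : Module S.K S.W := inferInstanceAs (Module S.K (S.comp 1))

namespace W

variable {S}

/-- The inclusion `W → C`. -/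
def val : S.W →+ S.C := (S.comp 1).subtype.toAddMonoidHom

theorem val_injective : Function.Injective (val : S.W →+ S.C) := Subtype.val_injective

theorem val_mem (w : S.W) : val w ∈ S.gr 1 := w.2

theorem val_smul (k : S.K) (w : S.W) : val (k • w) = S.etaC k * val w := rfl

/-- The right action of `K` on `W` is the multiplication of `C`. -/
instance : Module S.Kᵐᵒᵖ S.W where
  smul k w := ⟨val w * S.etaC k.unop, SetLike.GradedMul.mul_mem w.val_mem (S.etaC_mem k.unop)⟩
  one_smul w := val_injective (by
    change val w * S.etaC 1 = val w; rw [map_one, mul_one])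
  mul_smul k l w := val_injective (by
    change val w * S.etaC (l.unop * k.unop) = val w * S.etaC l.unop * S.etaC k.unop
    rw [map_mul, mul_assoc])
  smul_zero k := val_injective (zero_mul (S.etaC k.unop))
  smul_add k v w := val_injective (add_mul (val v) (val w) (S.etaC k.unop))
  add_smul k l w := val_injective (by
    change val w * S.etaC (k.unop + l.unop) = val w * S.etaC k.unop + val w * S.etaC l.unop
    rw [map_add, mul_add])
  zero_smul w := val_injective (by
    change val w * S.etaC 0 = 0; rw [map_zero, mul_zero])

theorem val_op_smul (k : S.K) (w : S.W) : val (op k • w) = val w * S.etaC k := rfl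

instance : SMulCommClass S.K S.Kᵐᵒᵖ S.W where
  smul_comm k l w := val_injective (mul_assoc (S.etaC k) (val w) (S.etaC l.unop)).symm

end W

/-- The product `W ⊗_K W → C`. -/
def mulW : BalTensor S.K S.W S.W →+ S.C :=
  BalTensor.lift S.K
    (AddMonoidHom.mk' (fun v => (AddMonoidHom.mulLeft v.val).comp W.val)
      (fun v w => by ext u; simp [add_mul]))
    (fun v k w => mul_assoc _ _ _)

/-- The quadratic relations `I_C ⊂ W ⊗_K W`: the kernel of the product `W ⊗_K W → C_2`. -/
def relationsC : AddSubgroup (BalTensor S.K S.W S.W) := S.mulW.ker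

/-- `C` is homogeneous quadratic over `K`: the canonical ring homomorphism
`T_K(W) / ⟨I_C⟩ → C` is bijective. -/
def IsHomogeneousQuadratic : Prop :=
  ∃ f : QuadraticRing S.K S.W S.relationsC →+* S.C,
    (∀ k, f (QuadraticRing.base S.K S.W S.relationsC k) = S.etaC k) ∧
    (∀ w, f (QuadraticRing.gen S.K S.W S.relationsC w) = W.val w) ∧
    Function.Bijective f

/-- Each component `C_n` is a finitely generated projective left `K`-module. -/
def IsLeftFGProjective : Prop :=
  ∀ n, Module.Finite S.K (S.comp n) ∧ Module.Projective S.K (S.comp n)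

/-- The quadratic dual `C^⊥` over `K`. -/
abbrev DualC : Type _ :=
  QuadraticRing S.K (LeftDual S.K S.W) (LeftDual.annihilator S.relationsC)

/-- The structure map `K → C^⊥`. -/
abbrev dualCBase : S.K →+* S.DualC :=
  QuadraticRing.base S.K (LeftDual S.K S.W) (LeftDual.annihilator S.relationsC)

/-- The generators `Hom_K(W, K) → C^⊥`. -/
abbrev dualCGen : LeftDual S.K S.W →+ S.DualC :=
  QuadraticRing.gen S.K (LeftDual S.K S.W) (LeftDual.annihilator S.relationsC)

/-- The map `R ⊗_K C → A` induced by the product of `A`. -/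
def mulMap : BalTensor S.K S.R S.C →+ S.A :=
  BalTensor.lift S.K
    (AddMonoidHom.mk' (fun r => (AddMonoidHom.mulLeft (S.iota r)).comp S.kappa.toAddMonoidHom)
      (fun r s => by ext c; simp [add_mul]))
    (fun r k c => by
      change S.iota (r * S.etaR k) * S.kappa c = S.iota r * S.kappa (S.etaC k * c)
      rw [map_mul, map_mul, S.comm, mul_assoc])

theorem mulMap_tmul (r : S.R) (c : S.C) :
    S.mulMap (BalTensor.tmul S.K r c) = S.iota r * S.kappa c := rfl

theorem mulMap_smul (r : S.R) (t : BalTensor S.K S.R S.C) :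
    S.mulMap (r • t) = S.iota r * S.mulMap t := by
  induction t using BalTensor.induction_on with
  | h0 => simp
  | ht s c =>
    rw [BalTensor.smul_tmul, mulMap_tmul, mulMap_tmul, smul_eq_mul, map_mul, mul_assoc]
  | ha x y hx hy => rw [smul_add, map_add, map_add, hx, hy, mul_add]

/-- `F_n A`: the image of `R ⊗_K F_n C` in `A`, where `F_n C = C_0 ⊕ ⋯ ⊕ C_n`. -/
def filtration (n : ℕ) : AddSubgroup S.A :=
  AddSubgroup.closure {a | ∃ (r : S.R), ∃ i ≤ n, ∃ c ∈ S.gr i, a = S.iota r * S.kappa c}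

/-- `F_n A` is a filtration of the ring `A`. -/
def IsFiltered : Prop :=
  ∀ (m n : ℕ) (a b : S.A), a ∈ S.filtration m → b ∈ S.filtration n → a * b ∈ S.filtration (m + n)

theorem filtration_mono : Monotone S.filtration := fun m n h =>
  AddSubgroup.closure_mono (by
    rintro _ ⟨r, i, hi, c, hc, rfl⟩
    exact ⟨r, i, hi.trans h, c, hc, rfl⟩)

theorem filtration_zero : S.filtration 0 = S.iota.range.toAddSubgroup := by
  apply le_antisymm
  · rw [filtration, AddSubgroup.closure_le]
    rintro _ ⟨r, i, hi, c, hc, rfl⟩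
    obtain rfl : i = 0 := Nat.le_zero.1 hi
    rw [S.gr_zero] at hc
    obtain ⟨k, rfl⟩ := hc
    exact ⟨r * S.etaR k, by rw [map_mul, S.comm]⟩
  · rintro _ ⟨r, rfl⟩
    refine AddSubgroup.subset_closure ⟨r, 0, le_rfl, 1, ?_, by simp⟩
    simpa using S.etaC_mem 1

theorem filtration_exhaustive (hA : Function.Bijective S.mulMap) (a : S.A) :
    ∃ n, a ∈ S.filtration n := by
  have key : ∀ a b, (∃ n, a ∈ S.filtration n) → (∃ n, b ∈ S.filtration n) →
      ∃ n, a + b ∈ S.filtration n := by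
    rintro a b ⟨m, hm⟩ ⟨n, hn⟩
    exact ⟨max m n, add_mem (S.filtration_mono (le_max_left m n) hm)
      (S.filtration_mono (le_max_right m n) hn)⟩
  obtain ⟨t, rfl⟩ := hA.2 a
  induction t using BalTensor.induction_on with
  | h0 => exact ⟨0, by rw [map_zero]; exact zero_mem _⟩
  | ht r c =>
    rw [mulMap_tmul]
    induction c using DirectSum.Decomposition.inductionOn S.gr with
    | zero => exact ⟨0, by rw [map_zero, mul_zero]; exact zero_mem _⟩
    | @homogeneous i c => exact ⟨i, AddSubgroup.subset_closure ⟨r, i, le_rfl, c, c.2, rfl⟩⟩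
    | add c c' hc hc' => rw [map_add, mul_add]; exact key _ _ hc hc'
  | ha x y hx hy => rw [map_add]; exact key _ _ hx hy

/-- The left `R`-linear map `A → R`, `r c ↦ r θ(c)`, which extends a left `K`-linear map
`θ : C → K`. -/
def extend (hA : Function.Bijective S.mulMap) (θ : S.C →ₗ[S.K] S.K) : S.A →+ S.R :=
  (BalTensor.lift S.K
    (AddMonoidHom.mk' (fun r => (AddMonoidHom.mulLeft r).comp
        (S.etaR.toAddMonoidHom.comp θ.toAddMonoidHom))
      (fun r s => by ext c; simp [add_mul]))
    (fun r k c => by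
      change r * S.etaR k * S.etaR (θ c) = r * S.etaR (θ (k • c))
      rw [map_smul, smul_eq_mul, map_mul, mul_assoc])).comp
  (AddEquiv.ofBijective S.mulMap hA).symm.toAddMonoidHom

section extend
variable {S}
variable (hA : Function.Bijective S.mulMap) (θ : S.C →ₗ[S.K] S.K)

theorem extend_mul_kappa (r : S.R) (c : S.C) :
    S.extend hA θ (S.iota r * S.kappa c) = r * S.etaR (θ c) := by
  have h : (AddEquiv.ofBijective S.mulMap hA).symm (S.iota r * S.kappa c) =
      BalTensor.tmul S.K r c := by
    rw [AddEquiv.symm_apply_eq]; rfl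
  rw [extend, AddMonoidHom.comp_apply]
  exact congrArg _ h

theorem extend_mul (r : S.R) (a : S.A) :
    S.extend hA θ (S.iota r * a) = r * S.extend hA θ a := by
  obtain ⟨t, rfl⟩ := hA.2 a
  induction t using BalTensor.induction_on with
  | h0 => simp
  | ht s c =>
    rw [mulMap_tmul, ← mul_assoc, ← map_mul, extend_mul_kappa, extend_mul_kappa, mul_assoc]
  | ha x y hx hy => rw [map_add, mul_add, map_add, map_add, hx, hy, mul_add]

end extend

theorem exists_proj_zero (c : S.C) : ∃ k, S.etaC k = (DirectSum.decompose S.gr c 0 : S.C) := by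
  have h : S.gr 0 ≤ S.etaC.range.toAddSubgroup := S.gr_zero.le
  exact h (SetLike.coe_mem (DirectSum.decompose S.gr c 0))

theorem decompose_smul (k : S.K) (c : S.C) (n : ℕ) :
    (DirectSum.decompose S.gr (k • c) n : S.C) = S.etaC k * DirectSum.decompose S.gr c n := by
  rw [smul_C, DirectSum.coe_decompose_mul_of_left_mem_zero S.gr (S.etaC_mem k)]

/-- The element of `K` which corresponds to the component of degree zero of `c`. -/
def epsCFun (c : S.C) : S.K := (S.exists_proj_zero c).choose

theorem etaC_epsCFun (c : S.C) :
    S.etaC (S.epsCFun c) = (DirectSum.decompose S.gr c 0 : S.C) :=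
  (S.exists_proj_zero c).choose_spec

/-- The augmentation `C → C_0 = K`. -/
def epsC : S.C →ₗ[S.K] S.K where
  toFun := S.epsCFun
  map_add' c c' := S.etaC_injective (by
    rw [map_add, etaC_epsCFun, etaC_epsCFun, etaC_epsCFun, DirectSum.decompose_add]; rfl)
  map_smul' k c := S.etaC_injective (by
    rw [RingHom.id_apply, smul_eq_mul, map_mul, etaC_epsCFun, etaC_epsCFun, decompose_smul])

theorem epsC_one : S.epsC 1 = 1 := S.etaC_injective (by
  have h : (1 : S.C) ∈ S.gr 0 := by simpa using S.etaC_mem 1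
  exact (S.etaC_epsCFun 1).trans
    ((DirectSum.decompose_of_mem_same S.gr h).trans (map_one S.etaC).symm))

/-- The projection `C → C_1 = W`. -/
def projW : S.C →ₗ[S.K] S.W where
  toFun c := ⟨DirectSum.decompose S.gr c 1, SetLike.coe_mem (DirectSum.decompose S.gr c 1)⟩
  map_add' c c' := W.val_injective (by
    change (DirectSum.decompose S.gr (c + c') 1 : S.C) =
      DirectSum.decompose S.gr c 1 + DirectSum.decompose S.gr c' 1
    rw [DirectSum.decompose_add]; rfl)
  map_smul' k c := W.val_injective (S.decompose_smul k c 1)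

/-- The filtered ring `(A, F)` with the map `eps = id_R ⊗ eps_C : A ≅ R ⊗_K C → R`. -/
def filteredRing (hA : Function.Bijective S.mulMap) (hF : S.IsFiltered) :
    SplitFilteredRing S.R S.A where
  iota := S.iota
  F := S.filtration
  F_zero := S.filtration_zero
  F_mono := S.filtration_mono
  F_exhaustive := S.filtration_exhaustive hA
  F_mul := fun ha hb => hF _ _ _ _ ha hb
  eps := S.extend hA S.epsC
  eps_mul := extend_mul hA S.epsC
  eps_iota := fun r => by
    have h := extend_mul_kappa hA S.epsC r 1
    rwa [map_one, mul_one, epsC_one, map_one, mul_one] at h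

/-- The inclusion `Hom_K(W, K) → Hom_R(V, R)`, where `V = R ⊗_K W`; it sends `φ` to
`r ⊗ w ↦ r φ(w)`. -/
def extendDual (hA : Function.Bijective S.mulMap) (hF : S.IsFiltered) (φ : LeftDual S.K S.W) :
    LeftDual S.R (S.filteredRing hA hF).Gen :=
  (⟨⟨fun v => S.extend hA (LinearMap.comp φ S.projW) v.val, fun v w => by simp⟩,
    fun r v => extend_mul hA _ r v.val⟩ : (S.filteredRing hA hF).Gen →ₗ[S.R] S.R)

end GradedSquare

end

/-! Everything rests on one identity for `A = R ⊗_K C`. If `θ : C → K` is left `K`-linear and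
`θ(c'c) = ε(c')θ(c)` for all `c'`, then the left `R`-linear extension of `θ` satisfies `θ(ac) =
ε(a·θ(c))` (`extend_mul_kappa_of_mul`). With `θ = ε_C` it says that `ε(ax)` depends on `x` only
through `ε(x)`, so `ker ε` is a left ideal and products of elements of `V` have no component in `R`:
the curvature is zero. With `θ = φ ∘ projW` and `c` in `W` it is responsible for `dφ = 0` on
`Hom_K(W, K)`.

A dual basis of `W` over `K` is also one of `V = R ⊗_K W` over `R`; this gives `Hom_R(V, R) =
Hom_K(W, K) ⊗_K R` and left linear sections. A functional on `W ⊗_K W` which kills `I_C` factors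
through `C₂`, because `W ⊗_K W → C₂` is onto. Extending such functionals to `A` shows that `I_C^⊥`
lies in `I_A^⊥`, and a dual basis of `C₂` shows that it generates `I_A^⊥` as a right `R`-module
(`extendDual₂_mem`, `mem_closure_of_mem_dualRelations`). Hence `C^⊥ ⊗_K R` maps onto the dual of
`A`. For injectivity the dual of `A` is made to act from the right on `C^⊥ ⊗_K R`, by `(c ⊗ s)ψ =
c·(sψ)`; the orbit map of `1 ⊗ 1` inverts the product map (`rightMulDual₂_eq_zero`,
`dualMul_injective`).

The differential is then defined by `d(cr) = (-1)ⁿ c q̂(r)` for `c` in `C^⊥` of degree `n`. It is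
compared with the form `D_ψ(t) = ⟨p t, ψ⟩ - q̃(t ⊗ ψ)` on `Î`. This form vanishes for `ψ` in
`Hom_K(W, K)` and obeys a product rule for `ψr`, so the pairing of `dψ` with `I_A` is `D_ψ` for
every `ψ`; since an element of degree two is determined by such a pairing, `dψ` can be read off from
`D_ψ` (`differential_gen_eq`). The product rule of `D` for `rψ` then yields the Leibniz rule for `R`
acting on the left, and `D_{q̂(r)} = 0` yields `d² = 0`. Uniqueness holds because a derivation is
determined by its values on generators. -/

noncomputable section

/-! ### Tensor products over a noncommutative ring: additivity and maps out of them. -/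

namespace BalTensor

variable {K M N P : Type*} [Ring K] [AddCommGroup M] [Module Kᵐᵒᵖ M]
  [AddCommGroup N] [Module K N] [AddCommGroup P]

theorem add_tmul (m m' : M) (n : N) : tmul K (m + m') n = tmul K m n + tmul K m' n := by
  rw [tmul, TensorProduct.add_tmul, map_add]; rfl

theorem tmul_add (m : M) (n n' : N) : tmul K m (n + n') = tmul K m n + tmul K m n' := by
  rw [tmul, TensorProduct.tmul_add, map_add]; rfl

theorem hom_ext {f g : BalTensor K M N →+ P} (h : ∀ m n, f (tmul K m n) = g (tmul K m n)) :
    f = g := by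
  refine AddMonoidHom.ext fun t => ?_
  induction t using induction_on with
  | h0 => simp
  | ht m n => exact h m n
  | ha x y hx hy => rw [map_add, map_add, hx, hy]

variable (K) in
/-- `m ⊗ n` as an additive function of `n`. -/
def tmulRight (m : M) : N →+ BalTensor K M N := AddMonoidHom.mk' (tmul K m) (tmul_add m)

variable (K) in
/-- `m ⊗ n` as an additive function of `m`. -/
def tmulLeft (n : N) : M →+ BalTensor K M N :=
  AddMonoidHom.mk' (fun m => tmul K m n) (fun m m' => add_tmul m m' n)

variable (K) in
/-- A balanced biadditive function induces an additive map on the tensor product. -/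
def liftFun (f : M → N → P) (h₁ : ∀ m m' n, f (m + m') n = f m n + f m' n)
    (h₂ : ∀ m n n', f m (n + n') = f m n + f m n')
    (hf : ∀ (m : M) (k : K) (n : N), f (op k • m) n = f m (k • n)) : BalTensor K M N →+ P :=
  lift K (AddMonoidHom.mk' (fun m => AddMonoidHom.mk' (f m) (h₂ m))
    (fun m m' => AddMonoidHom.ext fun n => h₁ m m' n)) hf

@[simp] theorem liftFun_tmul (f : M → N → P) (h₁ h₂ hf) (m : M) (n : N) :
    liftFun K f h₁ h₂ hf (tmul K m n) = f m n := rfl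

theorem tmul_sum {ι : Type*} (s : Finset ι) (m : M) (n : ι → N) :
    tmul K m (∑ i ∈ s, n i) = ∑ i ∈ s, tmul K m (n i) := map_sum (tmulRight K m) n s

theorem sum_tmul {ι : Type*} (s : Finset ι) (m : ι → M) (n : N) :
    tmul K (∑ i ∈ s, m i) n = ∑ i ∈ s, tmul K (m i) n := map_sum (tmulLeft K n) m s

end BalTensor

/-! ### Tensor rings and quadratic rings: universal properties and grading. -/

namespace TensorRing

variable {R V B : Type*} [Ring R] [AddCommGroup V] [Module R V] [Module Rᵐᵒᵖ V] [Ring B]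

theorem gen₂_tmul (v w : V) : gen₂ R V (BalTensor.tmul R v w) = gen R V v * gen R V w := rfl

/-- The universal property of the tensor ring. -/
def lift (f : R →+* B) (g : V →+ B) (hl : ∀ r v, g (r • v) = f r * g v)
    (hr : ∀ (r : R) v, g (op r • v) = g v * f r) : TensorRing R V →+* B :=
  RingQuot.lift ⟨(FreeAlgebra.lift ℤ (Sum.elim f g)).toRingHom, by
    rintro _ _ (_ | _ | _ | _ | _ | _) <;> simp [hl, hr]⟩

section
variable (f : R →+* B) (g : V →+ B) (hl : ∀ r v, g (r • v) = f r * g v)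
  (hr : ∀ (r : R) v, g (op r • v) = g v * f r)

theorem lift_base (r : R) : lift f g hl hr (base R V r) = f r := by
  change RingQuot.lift _ (RingQuot.mkRingHom _ _) = _
  rw [RingQuot.lift_mkRingHom_apply]
  simp

theorem lift_gen (v : V) : lift f g hl hr (gen R V v) = g v := by
  change RingQuot.lift _ (RingQuot.mkRingHom _ _) = _
  rw [RingQuot.lift_mkRingHom_apply]
  simp

end

theorem mk_surjective : Function.Surjective (mk : FreeAlgebra ℤ (R ⊕ V) →+* TensorRing R V) :=
  RingQuot.mkRingHom_surjective _

theorem induction_on {p : TensorRing R V → Prop} (x : TensorRing R V)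
    (hb : ∀ r, p (base R V r)) (hg : ∀ v, p (gen R V v)) (ha : ∀ x y, p x → p y → p (x + y))
    (hm : ∀ x y, p x → p y → p (x * y)) : p x := by
  obtain ⟨x, rfl⟩ := mk_surjective x
  induction x using FreeAlgebra.induction with
  | grade0 n =>
    -- Integer constants already come from `R`, so they need no case of their own.
    have : mk (algebraMap ℤ (FreeAlgebra ℤ (R ⊕ V)) n) = base R V (n : R) := by simp
    rw [this]; exact hb _
  | grade1 x =>
    rcases x with r | v
    · exact hb r
    · exact hg v
  | mul a b ha' hb' => rw [map_mul]; exact hm _ _ ha' hb'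
  | add a b ha' hb' => rw [map_add]; exact ha _ _ ha' hb'

end TensorRing

namespace QuadraticRing

variable {R V : Type*} [Ring R] [AddCommGroup V] [Module R V] [Module Rᵐᵒᵖ V]
  {I : AddSubgroup (BalTensor R V V)} {B : Type*} [Ring B]

theorem gen_smul (r : R) (v : V) : gen R V I (r • v) = base R V I r * gen R V I v :=
  (congrArg (mk R V I) (TensorRing.gen_smul r v)).trans (map_mul _ _ _)

theorem gen_op_smul (r : R) (v : V) : gen R V I (op r • v) = gen R V I v * base R V I r :=
  (congrArg (mk R V I) (TensorRing.gen_op_smul r v)).trans (map_mul _ _ _)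

theorem gen₂_tmul (v w : V) :
    gen₂ R V I (BalTensor.tmul R v w) = gen R V I v * gen R V I w :=
  map_mul (mk R V I) _ _

theorem gen₂_eq_zero {t : BalTensor R V V} (ht : t ∈ I) : gen₂ R V I t = 0 :=
  (RingQuot.mkRingHom_rel ⟨t, ht, rfl, rfl⟩).trans (map_zero _)

theorem op_smul_def (r : R) (x : QuadraticRing R V I) : op r • x = x * base R V I r := rfl

instance : SMulCommClass (QuadraticRing R V I) Rᵐᵒᵖ (QuadraticRing R V I) where
  smul_comm a r x := (mul_assoc a x (base R V I r.unop)).symm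

theorem mk_surjective : Function.Surjective (mk R V I) := RingQuot.mkRingHom_surjective _

@[elab_as_elim]
theorem induction_on {p : QuadraticRing R V I → Prop} (x : QuadraticRing R V I)
    (hb : ∀ r, p (base R V I r)) (hg : ∀ v, p (gen R V I v))
    (ha : ∀ x y, p x → p y → p (x + y)) (hm : ∀ x y, p x → p y → p (x * y)) : p x := by
  obtain ⟨x, rfl⟩ := mk_surjective x
  refine TensorRing.induction_on (p := fun x => p (mk R V I x)) x hb hg (fun x y hx hy => ?_)
    (fun x y hx hy => ?_)
  · rw [map_add]; exact ha _ _ hx hy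
  · rw [map_mul]; exact hm _ _ hx hy

/-- Induction by right multiplication with generators. -/
theorem induction_mul {p : QuadraticRing R V I → Prop} (x : QuadraticRing R V I) (h1 : p 1)
    (hb : ∀ x r, p x → p (x * base R V I r)) (hg : ∀ x v, p x → p (x * gen R V I v))
    (ha : ∀ x y, p x → p y → p (x + y)) : p x := by
  suffices h : ∀ y, p y → p (y * x) by simpa using h 1 h1
  induction x using induction_on with
  | hb r => exact fun y hy => hb y r hy
  | hg v => exact fun y hy => hg y v hy
  | ha a b iha ihb => intro y hy; rw [mul_add]; exact ha _ _ (iha y hy) (ihb y hy)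
  | hm a b iha ihb => intro y hy; rw [← mul_assoc]; exact ihb _ (iha y hy)

/-- The universal property of the quadratic ring `T_R(V) / ⟨I⟩`. -/
def lift (f : R →+* B) (g : V →+ B) (hl : ∀ r v, g (r • v) = f r * g v)
    (hr : ∀ (r : R) v, g (op r • v) = g v * f r) (G : BalTensor R V V →+ B)
    (hG : ∀ v w, G (BalTensor.tmul R v w) = g v * g w) (hI : ∀ t ∈ I, G t = 0) :
    QuadraticRing R V I →+* B :=
  RingQuot.lift ⟨TensorRing.lift f g hl hr, by
    rintro _ _ ⟨t, ht, rfl, rfl⟩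
    -- `G` is forced by `hG`; having it as an argument lets `hI` be checked on a map with a known
    -- description.
    have h : (TensorRing.lift f g hl hr).toAddMonoidHom.comp (TensorRing.gen₂ R V) = G := by
      refine BalTensor.hom_ext fun v w => ?_
      rw [hG]
      rw [AddMonoidHom.comp_apply, TensorRing.gen₂_tmul, RingHom.toAddMonoidHom_eq_coe,
        AddMonoidHom.coe_coe, map_mul, TensorRing.lift_gen, TensorRing.lift_gen]
    rw [map_zero, ← hI t ht, ← h]; rfl⟩

section
variable (f : R →+* B) (g : V →+ B) (hl : ∀ r v, g (r • v) = f r * g v)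
  (hr : ∀ (r : R) v, g (op r • v) = g v * f r) (G : BalTensor R V V →+ B)
  (hG : ∀ v w, G (BalTensor.tmul R v w) = g v * g w) (hI : ∀ t ∈ I, G t = 0)

@[simp] theorem lift_base (r : R) : lift f g hl hr G hG hI (base R V I r) = f r := by
  change RingQuot.lift _ (RingQuot.mkRingHom _ _) = _
  rw [RingQuot.lift_mkRingHom_apply]
  exact TensorRing.lift_base f g hl hr r

@[simp] theorem lift_gen (v : V) : lift f g hl hr G hG hI (gen R V I v) = g v := by
  change RingQuot.lift _ (RingQuot.mkRingHom _ _) = _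
  rw [RingQuot.lift_mkRingHom_apply]
  exact TensorRing.lift_gen f g hl hr v

end

/-! ### The grading -/

theorem gen₂_mem_grade (t : BalTensor R V V) : gen₂ R V I t ∈ grade R V I 2 := by
  induction t using BalTensor.induction_on with
  | h0 => rw [map_zero]; exact zero_mem _
  | ht v w =>
    refine AddSubgroup.subset_closure ⟨v, gen R V I w, ?_, gen₂_tmul v w⟩
    exact AddSubgroup.subset_closure ⟨w, 1, ⟨1, map_one _⟩, (mul_one _).symm⟩
  | ha x y hx hy => rw [map_add]; exact add_mem hx hy

theorem one_mem_grade : (1 : QuadraticRing R V I) ∈ grade R V I 0 := ⟨1, map_one _⟩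

theorem base_mem_grade (r : R) : base R V I r ∈ grade R V I 0 := ⟨r, rfl⟩

theorem gen_mem_grade (v : V) : gen R V I v ∈ grade R V I 1 :=
  AddSubgroup.subset_closure ⟨v, 1, one_mem_grade, (mul_one _).symm⟩

/-- In positive degree the scalar is absorbed by the leftmost generator: `r(vb) = (rv)b`. -/
theorem base_mul_mem_grade (r : R) {n : ℕ} {b : QuadraticRing R V I} (hb : b ∈ grade R V I n) :
    base R V I r * b ∈ grade R V I n := by
  cases n with
  | zero => obtain ⟨s, rfl⟩ := hb; exact ⟨r * s, map_mul _ _ _⟩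
  | succ n =>
    refine AddSubgroup.closure_induction (p := fun b _ => base R V I r * b ∈ grade R V I (n + 1))
      ?_ ?_ ?_ ?_ hb
    · rintro _ ⟨v, b, hb, rfl⟩
      exact AddSubgroup.subset_closure ⟨r • v, b, hb, by rw [gen_smul, mul_assoc]⟩
    · rw [mul_zero]; exact zero_mem _
    · intro x y _ _ hx hy; rw [mul_add]; exact add_mem hx hy
    · intro x _ hx; rw [mul_neg]; exact neg_mem hx

theorem mul_mem_grade {m n : ℕ} {a b : QuadraticRing R V I} (ha : a ∈ grade R V I m)
    (hb : b ∈ grade R V I n) : a * b ∈ grade R V I (m + n) := by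
  induction m generalizing a with
  | zero => obtain ⟨r, rfl⟩ := ha; rw [zero_add]; exact base_mul_mem_grade r hb
  | succ m ih =>
    refine AddSubgroup.closure_induction (p := fun a _ => a * b ∈ grade R V I (m + 1 + n))
      ?_ ?_ ?_ ?_ ha
    · rintro _ ⟨v, a, ha, rfl⟩
      rw [Nat.succ_add, mul_assoc]
      exact AddSubgroup.subset_closure ⟨v, a * b, ih ha, rfl⟩
    · rw [zero_mul]; exact zero_mem _
    · intro x y _ _ hx hy; rw [add_mul]; exact add_mem hx hy
    · intro x _ hx; rw [neg_mul]; exact neg_mem hx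

theorem gradedMonoid_grade : SetLike.GradedMonoid (grade R V I) where
  one_mem := one_mem_grade
  mul_mem _ _ _ _ ha hb := mul_mem_grade ha hb

open Polynomial in
variable (R V I) in
/-- The grading as a coaction: `b ↦ b Xⁿ` on the component of degree `n`. -/
def coaction : QuadraticRing R V I →+* (QuadraticRing R V I)[X] :=
  lift (C.comp (base R V I)) ((monomial 1).toAddMonoidHom.comp (gen R V I))
    (fun r v => by
      change monomial 1 (gen R V I (r • v)) = C _ * monomial 1 _
      rw [gen_smul, C_mul_monomial])
    (fun r v => by
      change monomial 1 (gen R V I (op r • v)) = monomial 1 _ * C _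
      rw [gen_op_smul, monomial_mul_C])
    ((monomial 2).toAddMonoidHom.comp (gen₂ R V I))
    (fun v w => by
      change monomial 2 (gen₂ R V I _) = monomial 1 _ * monomial 1 _
      rw [gen₂_tmul, monomial_mul_monomial])
    (fun t ht => by
      change monomial 2 (gen₂ R V I _) = 0
      rw [gen₂_eq_zero ht, map_zero])

open Polynomial in
theorem coaction_gen (v : V) : coaction R V I (gen R V I v) = monomial 1 (gen R V I v) :=
  lift_gen _ _ _ _ _ _ _ v

open Polynomial in
theorem coaction_base (r : R) : coaction R V I (base R V I r) = C (base R V I r) :=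
  lift_base _ _ _ _ _ _ _ r

open Polynomial in
theorem coaction_of_mem {n : ℕ} {b : QuadraticRing R V I} (hb : b ∈ grade R V I n) :
    coaction R V I b = monomial n b := by
  induction n generalizing b with
  | zero => obtain ⟨r, rfl⟩ := hb; exact coaction_base r
  | succ n ih =>
    refine AddSubgroup.closure_induction (p := fun b _ => coaction R V I b = monomial (n + 1) b)
      ?_ ?_ ?_ ?_ hb
    · rintro _ ⟨v, b, hb, rfl⟩
      rw [map_mul, ih hb, coaction_gen, monomial_mul_monomial, add_comm]
    · simp
    · intro x y _ _ hx hy; rw [map_add, map_add, hx, hy]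
    · intro x _ hx; rw [map_neg, map_neg, hx]

theorem coeff_coaction_mem (b : QuadraticRing R V I) (n : ℕ) :
    (coaction R V I b).coeff n ∈ grade R V I n := by
  induction b using induction_on generalizing n with
  | hb r =>
    rw [coaction_base, Polynomial.coeff_C]
    split_ifs with h
    · subst h; exact base_mem_grade r
    · exact zero_mem _
  | hg v =>
    rw [coaction_gen, Polynomial.coeff_monomial]
    split_ifs with h
    · subst h; exact gen_mem_grade v
    · exact zero_mem _
  | ha x y hx hy => rw [map_add, Polynomial.coeff_add]; exact add_mem (hx n) (hy n)
  | hm x y hx hy =>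
    rw [map_mul, Polynomial.coeff_mul]
    refine sum_mem fun i hi => ?_
    rw [← Finset.HasAntidiagonal.mem_antidiagonal.1 hi]
    exact mul_mem_grade (hx _) (hy _)

/-- Evaluation at `X = 1` is a ring homomorphism, since `1` is central, and after the coaction it is
the identity on generators. -/
theorem sum_coeff_coaction (b : QuadraticRing R V I) :
    (coaction R V I b).sum (fun _ a => a) = b := by
  have h : ∀ p : Polynomial (QuadraticRing R V I), Polynomial.eval₂RingHom' (RingHom.id _) 1
      (fun a => Commute.one_right a) p = p.sum fun _ a => a := fun p => by
    simp [Polynomial.eval₂RingHom', Polynomial.eval₂_eq_sum]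
  rw [← h]
  induction b using induction_on with
  | hb r => rw [coaction_base, h, Polynomial.sum_C_index rfl]
  | hg v => rw [coaction_gen, h, Polynomial.sum_monomial_index _ _ rfl]
  | ha x y hx hy => rw [map_add, map_add, hx, hy]
  | hm x y hx hy => rw [map_mul, map_mul, hx, hy]

/-- The coefficients of the coaction recover the components of a sum, which gives independence; they
add up to the element itself, which gives spanning. -/
theorem isInternal_grade : DirectSum.IsInternal (grade R V I) := by
  constructor
  · have h : ∀ (x : DirectSum ℕ fun n => grade R V I n) (n : ℕ),
        (coaction R V I (DirectSum.coeAddMonoidHom (grade R V I) x)).coeff n = x n := by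
      intro x n
      induction x using DirectSum.induction_on with
      | zero => simp
      | of i b =>
        rw [DirectSum.coeAddMonoidHom_of, coaction_of_mem b.2, Polynomial.coeff_monomial,
          DirectSum.coe_of_apply]
        split_ifs <;> rfl
      | add x y hx hy => simp [hx, hy]
    intro x y hxy
    refine DFinsupp.ext fun n => Subtype.ext ?_
    rw [← h, ← h, hxy]
  · intro b
    refine ⟨∑ n ∈ (coaction R V I b).support,
      DirectSum.of (fun n => grade R V I n) n ⟨_, coeff_coaction_mem b n⟩, ?_⟩
    rw [map_sum]
    simp only [DirectSum.coeAddMonoidHom_of]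
    exact sum_coeff_coaction b

/-! ### The components of degree zero and one -/

/-- The quotient of `T_R(V) / ⟨I⟩` by the components of degree at least two. -/
def toTrivSqZeroExt [SMulCommClass R Rᵐᵒᵖ V] : QuadraticRing R V I →+* TrivSqZeroExt R V :=
  lift (TrivSqZeroExt.inlHom R V) (TrivSqZeroExt.inrHom R V).toAddMonoidHom
    (fun r v => by ext <;> simp) (fun r v => by ext <;> simp) 0
    (fun v w => by
      change 0 = TrivSqZeroExt.inr v * TrivSqZeroExt.inr w
      rw [TrivSqZeroExt.inr_mul_inr]) (fun _ _ => rfl)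

/-- The relations have degree two, so they disappear in the trivial square-zero extension `R ⊕ V`,
where `R` and `V` remain visible. -/
theorem base_injective [SMulCommClass R Rᵐᵒᵖ V] : Function.Injective (base R V I) := by
  intro r s h
  have h' := congrArg (fun x => (toTrivSqZeroExt x).fst) h
  simpa [toTrivSqZeroExt] using h'

theorem gen_injective [SMulCommClass R Rᵐᵒᵖ V] : Function.Injective (gen R V I) := by
  intro r s h
  have h' := congrArg (fun x => (toTrivSqZeroExt x).snd) h
  simpa [toTrivSqZeroExt] using h'

/-! ### The sign automorphism -/

variable (R V I) in
/-- The endomorphism of `T_R(V) / ⟨I⟩` which is `(-1) ^ n` on the component of degree `n`. -/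
def sign : QuadraticRing R V I →+* QuadraticRing R V I :=
  lift (base R V I) (-gen R V I) (fun r v => by simp [gen_smul]) (fun r v => by simp [gen_op_smul])
    (gen₂ R V I) (fun v w => by simp [gen₂_tmul]) (fun _ ht => gen₂_eq_zero ht)

@[simp] theorem sign_base (r : R) : sign R V I (base R V I r) = base R V I r :=
  lift_base _ _ _ _ _ _ _ r

@[simp] theorem sign_gen (v : V) : sign R V I (gen R V I v) = -gen R V I v :=
  lift_gen _ _ _ _ _ _ _ v

theorem sign_of_mem {n : ℕ} {b : QuadraticRing R V I} (hb : b ∈ grade R V I n) :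
    sign R V I b = (-1) ^ n * b := by
  induction n generalizing b with
  | zero => obtain ⟨r, rfl⟩ := hb; rw [pow_zero, one_mul]; exact sign_base r
  | succ n ih =>
    refine AddSubgroup.closure_induction (p := fun b _ => sign R V I b = (-1) ^ (n + 1) * b)
      ?_ ?_ ?_ ?_ hb
    · rintro _ ⟨v, b, hb, rfl⟩
      rw [map_mul, ih hb, sign_gen, pow_succ, mul_neg_one, neg_mul, neg_mul, ← mul_assoc,
        ← mul_assoc, ((Commute.neg_one_right (gen R V I v)).pow_right n).eq]
    · simp
    · intro x y _ _ hx hy; rw [map_add, mul_add, hx, hy]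
    · intro x _ hx; rw [map_neg, mul_neg, hx]

end QuadraticRing

/-! ### Left duals, dual bases and the pairing in degree two. -/

namespace LeftDual

section
variable {R V : Type*} [Ring R] [AddCommGroup V] [Module R V]

/-- A left linear function as an element of the left dual. -/
def ofFun (f : V → R) (hadd : ∀ v w, f (v + w) = f v + f w) (hsmul : ∀ r v, f (r • v) = r * f v) :
    LeftDual R V :=
  (⟨⟨f, hadd⟩, hsmul⟩ : V →ₗ[R] R)

theorem sum_apply {ι : Type*} (s : Finset ι) (f : ι → LeftDual R V) (v : V) :
    (∑ i ∈ s, f i) v = ∑ i ∈ s, f i v :=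
  map_sum (AddMonoidHom.mk' (fun f : LeftDual R V => f v) fun _ _ => rfl) f s

/-- A dual basis of the left module `V` is at the same time one of the right module `V^∨`: apply `f`
to the expansion of `v`. -/
theorem sum_op_smul {ι : Type*} [Fintype ι] {x : ι → V} {x' : ι → LeftDual R V}
    (hx : ∀ v, ∑ i, x' i v • x i = v) (f : LeftDual R V) :
    ∑ i, op (f (x i)) • x' i = f := by
  refine ext fun v => ?_
  conv_rhs => rw [← hx v]
  rw [sum_apply, map_sum]
  simp only [op_smul_apply, map_smul]

end

variable {R V : Type*} [Ring R] [AddCommGroup V] [Module R V] [Module Rᵐᵒᵖ V]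
  [SMulCommClass R Rᵐᵒᵖ V]

instance : SMulCommClass R Rᵐᵒᵖ (LeftDual R V) where
  smul_comm _ _ _ := rfl

/-- The pairing with an element of `Hom_R(V, R) ⊗_R Hom_R(V, R)` as a left linear functional. -/
def pairingₗ (t : BalTensor R (LeftDual R V) (LeftDual R V)) : BalTensor R V V →ₗ[R] R where
  toFun := pairing t
  map_add' := map_add _
  map_smul' r z := by
    rw [RingHom.id_apply, smul_eq_mul]
    induction t using BalTensor.induction_on with
    | h0 => simp
    | ht f g =>
      induction z using BalTensor.induction_on with
      | h0 => simp
      | ht v u =>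
        rw [BalTensor.smul_tmul, pairing_tmul, pairing_tmul, ← smul_comm, map_smul]
      | ha x y hx hy => rw [smul_add, map_add, map_add, hx, hy, mul_add]
    | ha x y hx hy => rw [map_add, AddMonoidHom.add_apply, AddMonoidHom.add_apply, hx, hy, mul_add]

theorem pairingₗ_apply (t : BalTensor R (LeftDual R V) (LeftDual R V)) (z : BalTensor R V V) :
    pairingₗ t z = pairing t z := rfl

section dualBasis
variable {ι : Type*} [Fintype ι] {x : ι → V} {x' : ι → LeftDual R V}

/-- The functional `v ↦ F (v ⊗ u)`. -/
def contract (F : BalTensor R V V →ₗ[R] R) (u : V) : LeftDual R V :=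
  ofFun (fun v => F (BalTensor.tmul R v u)) (fun v w => by rw [BalTensor.add_tmul, map_add])
    (fun r v => by rw [← BalTensor.smul_tmul, LinearMap.map_smul, smul_eq_mul])

@[simp] theorem contract_apply (F : BalTensor R V V →ₗ[R] R) (u v : V) :
    contract F u v = F (BalTensor.tmul R v u) := rfl

variable (x x') in
/-- The element of `Hom_R(V, R) ⊗_R Hom_R(V, R)` attached to a functional on `V ⊗_R V` by means of
a dual basis of `V`. -/
def ofFunctional (F : BalTensor R V V →ₗ[R] R) : BalTensor R (LeftDual R V) (LeftDual R V) :=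
  ∑ i, BalTensor.tmul R (x' i) (contract F (x i))

/-- Moving the scalar `x' i u` across the tensor sign collects the sum into `v ⊗ ∑ x' i u • x i = v
⊗ u`. -/
theorem pairing_ofFunctional (hx : ∀ v, ∑ i, x' i v • x i = v) (F : BalTensor R V V →ₗ[R] R)
    (z : BalTensor R V V) : pairing (ofFunctional x x' F) z = F z := by
  induction z using BalTensor.induction_on with
  | h0 => simp
  | ht v u =>
    rw [ofFunctional, map_sum, AddMonoidHom.finsetSum_apply]
    simp only [pairing_tmul, contract_apply, BalTensor.balanced]
    rw [← map_sum, ← BalTensor.tmul_sum, hx]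
  | ha x y hx hy => rw [map_add, map_add, hx, hy]

/-- With `pairing_ofFunctional` this identifies `V^∨ ⊗_R V^∨` with the left dual of `V ⊗_R V`. -/
theorem ofFunctional_pairingₗ (hx : ∀ v, ∑ i, x' i v • x i = v)
    (t : BalTensor R (LeftDual R V) (LeftDual R V)) : ofFunctional x x' (pairingₗ t) = t := by
  induction t using BalTensor.induction_on with
  | h0 =>
    refine Finset.sum_eq_zero fun i _ => ?_
    have h : contract (pairingₗ (R := R) (V := V) 0) (x i) = 0 := ext fun v => by
      rw [contract_apply, pairingₗ_apply, map_zero, AddMonoidHom.zero_apply, zero_apply]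
    rw [h]
    exact map_zero (BalTensor.tmulRight R (x' i))
  | ht f g =>
    conv_rhs => rw [← sum_op_smul hx f, BalTensor.sum_tmul]
    refine Finset.sum_congr rfl fun i _ => ?_
    rw [BalTensor.balanced]
    rfl
  | ha s t hs ht =>
    conv_rhs => rw [← hs, ← ht]
    rw [ofFunctional, ofFunctional, ofFunctional, ← Finset.sum_add_distrib]
    refine Finset.sum_congr rfl fun i _ => ?_
    rw [← BalTensor.tmul_add]
    refine congrArg _ (ext fun v => ?_)
    simp only [add_apply, contract_apply, pairingₗ_apply, map_add, AddMonoidHom.add_apply]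

/-- Allows identities in `V^∨ ⊗_R V^∨` to be checked on values. -/
theorem pairing_injective (hx : ∀ v, ∑ i, x' i v • x i = v)
    {s t : BalTensor R (LeftDual R V) (LeftDual R V)} (h : ∀ z, pairing s z = pairing t z) :
    s = t := by
  rw [← ofFunctional_pairingₗ hx s, ← ofFunctional_pairingₗ hx t]
  exact congrArg _ (LinearMap.ext h)

/-- A left linear section of `V ⊗ V → V ⊗_R V`. -/
def tensorSection (x : ι → V) (x' : ι → LeftDual R V) : BalTensor R V V →ₗ[R] V ⊗[ℤ] V where
  toFun := BalTensor.liftFun R (fun v u => ∑ i, (op (x' i u) • v) ⊗ₜ[ℤ] x i)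
    (fun v v' u => by simp only [smul_add, TensorProduct.add_tmul, Finset.sum_add_distrib])
    (fun v u u' => by
      simp only [map_add, op_add, add_smul, TensorProduct.add_tmul, Finset.sum_add_distrib])
    (fun v r u => by simp only [map_smul, op_mul, mul_smul])
  map_add' := map_add _
  map_smul' r z := by
    induction z using BalTensor.induction_on with
    | h0 => simp
    | ht v u =>
      rw [BalTensor.smul_tmul, BalTensor.liftFun_tmul, BalTensor.liftFun_tmul, RingHom.id_apply,
        Finset.smul_sum]
      simp only [← smul_comm r, TensorProduct.smul_tmul']
    | ha x y hx hy => rw [smul_add, map_add, map_add, hx, hy, smul_add]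

theorem proj_tensorSection (hx : ∀ v, ∑ i, x' i v • x i = v) (z : BalTensor R V V) :
    BalTensor.proj R (tensorSection x x' z) = z := by
  induction z using BalTensor.induction_on with
  | h0 => simp
  | ht v u =>
    change BalTensor.proj R (∑ i, (op (x' i u) • v) ⊗ₜ[ℤ] x i) = _
    rw [map_sum]
    change ∑ i, BalTensor.tmul R (op (x' i u) • v) (x i) = _
    simp only [BalTensor.balanced]
    rw [← BalTensor.tmul_sum, hx]
  | ha x y hx hy => rw [map_add, map_add, hx, hy]

end dualBasis

/-- The right action of `s` on the second factor of `V ⊗_R V`. -/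
def translate (s : R) : BalTensor R V V →+ BalTensor R V V :=
  BalTensor.liftFun R (fun v u => BalTensor.tmul R v (op s • u))
    (fun v v' u => BalTensor.add_tmul _ _ _)
    (fun v u u' => by rw [smul_add, BalTensor.tmul_add])
    (fun v r u => by rw [BalTensor.balanced, smul_comm])

theorem pairing_smul (s : R) (t : BalTensor R (LeftDual R V) (LeftDual R V))
    (z : BalTensor R V V) : pairing (s • t) z = pairing t (translate s z) := by
  induction t using BalTensor.induction_on with
  | h0 => simp
  | ht f g =>
    induction z using BalTensor.induction_on with
    | h0 => simp
    | ht v u => rfl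
    | ha x y hx hy => rw [map_add, map_add, map_add, hx, hy]
  | ha x y hx hy => rw [smul_add, map_add, AddMonoidHom.add_apply, map_add,
      AddMonoidHom.add_apply, hx, hy]

/-- The left action on `V^∨ ⊗_R V^∨` is adjoint to the right action on `V ⊗_R V`. -/
theorem smul_mem_annihilator {I : AddSubgroup (BalTensor R V V)} {s : R}
    (hI : ∀ z ∈ I, translate s z ∈ I) {t : BalTensor R (LeftDual R V) (LeftDual R V)}
    (ht : t ∈ annihilator I) : s • t ∈ annihilator I := fun z hz => by
  rw [pairing_smul]; exact ht _ (hI z hz)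

end LeftDual

/-! ### Split filtered rings: the calculus of `q` and of the form that describes `dψ`. -/

namespace SplitFilteredRing

variable {R A : Type*} [Ring R] [Ring A] (T : SplitFilteredRing R A)

@[simp] theorem mu_tmul (v w : T.Gen) : T.mu (v ⊗ₜ[ℤ] w) = v.val * w.val := rfl

@[simp] theorem qhat_apply (r : R) (v : T.Gen) : T.qhat r v = T.q v r := rfl

theorem qtilde_tmul (φ : LeftDual R T.Gen) (v w : T.Gen) :
    T.qtilde φ (v ⊗ₜ[ℤ] w) = T.q v (φ w) := rfl

variable {T}

/-- The commutation rule of `A`: a generator moves past a scalar by the bimodule action, with `q` as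
the error term. -/
theorem val_mul_iota (v : T.Gen) (r : R) :
    v.val * T.iota r = (op r • v).val + T.iota (T.q v r) := by
  rw [Gen.val_op_smul, q, sub_add_cancel]

/-- This is the component in `R` of the associativity `v(rs) = (vr)s`. On the dual side it is the
Leibniz rule of `q̂`. -/
theorem q_mul (v : T.Gen) (r s : R) : T.q v (r * s) = T.q v r * s + T.q (op r • v) s := by
  have h : v.val * T.iota (r * s) = (op r • v).val * T.iota s + T.iota (T.q v r * s) := by
    rw [map_mul, ← mul_assoc, val_mul_iota, add_mul, map_mul]
  rw [q, h, map_add, T.eps_iota, add_comm]; rfl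

theorem q_add (v : T.Gen) (r s : R) : T.q v (r + s) = T.q v r + T.q v s := by
  simp [q, mul_add]

theorem q_one (v : T.Gen) : T.q v 1 = 0 := by simp [q]

theorem qhat_mul (r s : R) : T.qhat (r * s) = op s • T.qhat r + r • T.qhat s :=
  LeftDual.ext fun v => q_mul v r s

theorem qhat_add (r s : R) : T.qhat (r + s) = T.qhat r + T.qhat s :=
  LeftDual.ext fun v => q_add v r s

theorem qhat_one : T.qhat 1 = 0 := LeftDual.ext fun v => q_one v

/-- Elements of `V^∨ ⊗_R V^∨` with the same restriction to `I_A` define the same element of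
`(gr^F A)^⊥`. -/
theorem gen₂_eq_of_pairing {s t : BalTensor R (LeftDual R T.Gen) (LeftDual R T.Gen)}
    (h : ∀ i ∈ T.relations, LeftDual.pairing s i = LeftDual.pairing t i) :
    QuadraticRing.gen₂ R (LeftDual R T.Gen) T.dualRelations s =
      QuadraticRing.gen₂ R (LeftDual R T.Gen) T.dualRelations t := by
  rw [← sub_eq_zero, ← map_sub]
  refine QuadraticRing.gen₂_eq_zero fun i hi => ?_
  rw [map_sub, AddMonoidHom.sub_apply, h i hi, sub_self]

theorem pairsTo_unique {b b' : T.Dual} {f : T.relations → R} (h : T.PairsTo b f)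
    (h' : T.PairsTo b' f) : b = b' := by
  obtain ⟨t, rfl, ht⟩ := h
  obtain ⟨t', rfl, ht'⟩ := h'
  exact gen₂_eq_of_pairing fun i hi => (ht ⟨i, hi⟩).trans (ht' ⟨i, hi⟩).symm

variable (T) in
/-- The function `t ↦ ⟨p t, ψ⟩ - q̃(t ⊗ ψ)` on `Î`, which describes the differential of `ψ`. -/
def differentialForm (ψ : LeftDual R T.Gen) (t : T.liftedRelations) : R :=
  ψ (T.p t) - T.qtilde ψ t

theorem differentialForm_add (ψ ψ' : LeftDual R T.Gen) (t : T.liftedRelations) :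
    T.differentialForm (ψ + ψ') t = T.differentialForm ψ t + T.differentialForm ψ' t := by
  have h : ∀ t, T.qtilde (ψ + ψ') t = T.qtilde ψ t + T.qtilde ψ' t := fun t => by
    induction t with
    | zero => simp
    | tmul v w => simp only [qtilde_tmul, LeftDual.add_apply, q_add]
    | add x y hx hy => rw [map_add, map_add, map_add, hx, hy]; abel
  rw [differentialForm, differentialForm, differentialForm, h, LeftDual.add_apply]; abel

/-- By `q_mul`, `q(v, φ(w)r)` is `q(v, φ(w))r + q(vφ(w), r)`, and the last term is a pairing with `φ
⊗ q̂(r)`. This is the shadow of `d(φr) = d(φ)r - φ d(r)`. -/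
theorem differentialForm_op_smul (φ : LeftDual R T.Gen) (r : R) (t : T.liftedRelations) :
    T.differentialForm (op r • φ) t = T.differentialForm φ t * r -
      LeftDual.pairing (BalTensor.tmul R φ (T.qhat r)) (BalTensor.proj R (t : T.Gen ⊗[ℤ] T.Gen)) := by
  have h : ∀ t, T.qtilde (op r • φ) t = T.qtilde φ t * r +
      LeftDual.pairing (BalTensor.tmul R φ (T.qhat r)) (BalTensor.proj R t) := fun t => by
    induction t with
    | zero => simp
    | tmul v w => exact q_mul v (φ w) r
    | add x y hx hy => rw [map_add, map_add, map_add, map_add, hx, hy, add_mul]; abel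
  rw [differentialForm, differentialForm, h, LeftDual.op_smul_apply, sub_mul, sub_sub]

/-- A dual basis splits `V ⊗ V → V ⊗_R V`; the splitting restricts to `I_A` because `Î` is the full
preimage. -/
theorem nonempty_section {ι : Type*} [Fintype ι] {x : ι → T.Gen} {x' : ι → LeftDual R T.Gen}
    (hx : ∀ v, ∑ i, x' i v • x i = v) : Nonempty T.Section :=
  ⟨⟨(LeftDual.tensorSection x x').restrict fun z hz => by
      change BalTensor.proj R (LeftDual.tensorSection x x' z) ∈ T.relations
      rwa [LeftDual.proj_tensorSection hx],
    LinearMap.ext fun z => Subtype.ext (LeftDual.proj_tensorSection hx z.1)⟩⟩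

section leftAugmentation

variable (hL : T.IsLeftAugmentation)
include hL

/-- Every product ends with a factor in the left ideal `ker eps`. -/
theorem eps_mu (t : T.Gen ⊗[ℤ] T.Gen) : T.eps (T.mu t) = 0 := by
  induction t with
  | zero => simp
  | tmul v w => exact hL _ _ (Gen.eps_val w)
  | add x y hx hy => rw [map_add, map_add, hx, hy, add_zero]

theorem curvature_eq_zero (t : T.liftedRelations) : T.curvature t = 0 := eps_mu hL _

theorem val_p (t : T.liftedRelations) : (T.p t).val = T.mu t := by
  change T.mu t - T.iota (T.curvature t) = _
  rw [curvature_eq_zero hL, map_zero, sub_zero]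

omit hL in
variable (T) in
/-- The right action of `r` on the second factor of `V ⊗ V`. -/
def translate (r : R) : T.Gen ⊗[ℤ] T.Gen →+ T.Gen ⊗[ℤ] T.Gen :=
  tensorLift (AddMonoidHom.mk' (fun v => AddMonoidHom.mk' (fun w => v ⊗ₜ[ℤ] (op r • w))
    (fun w w' => by rw [smul_add, TensorProduct.tmul_add]))
    (fun v v' => AddMonoidHom.ext fun w => TensorProduct.add_tmul _ _ _))

omit hL in
theorem proj_translate (r : R) (t : T.Gen ⊗[ℤ] T.Gen) :
    BalTensor.proj R (T.translate r t) = LeftDual.translate r (BalTensor.proj R t) := by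
  induction t with
  | zero => simp
  | tmul v w => rfl
  | add x y hx hy => simp only [map_add, hx, hy]

omit hL in
variable (T) in
/-- The map `v ⊗ w ↦ v q(w ⊗ r)`. -/
def contractQ (r : R) : T.Gen ⊗[ℤ] T.Gen →+ T.Gen :=
  tensorLift (AddMonoidHom.mk' (fun v => AddMonoidHom.mk' (fun w => op (T.q w r) • v)
    (fun w w' => by rw [← add_smul, ← op_add]; simp [q, add_mul]))
    (fun v v' => AddMonoidHom.ext fun w => smul_add _ _ _))

/-- The scalar is moved past both factors: `vwr` consists of `v` times the action of `r` on `w`, the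
action of `q(w, r)` on `v`, and the scalar `q(v, q(w, r))`. Written as a value of `eps`, the scalar
is visibly additive in `t`. -/
theorem mu_mul_iota (r : R) (t : T.Gen ⊗[ℤ] T.Gen) :
    T.mu t * T.iota r = T.mu (T.translate r t) + (T.contractQ r t).val +
      T.iota (T.eps (T.mu t * T.iota r)) := by
  induction t with
  | zero => simp
  | tmul v w =>
    have h : T.mu (v ⊗ₜ[ℤ] w) * T.iota r = T.mu (T.translate r (v ⊗ₜ[ℤ] w)) +
        (T.contractQ r (v ⊗ₜ[ℤ] w)).val + T.iota (T.q v (T.q w r)) := by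
      rw [mu_tmul, mul_assoc, val_mul_iota, mul_add, val_mul_iota, add_assoc]; rfl
    -- The first two terms lie in `ker eps`, so `eps` isolates the third.
    have h' : T.eps (T.mu (v ⊗ₜ[ℤ] w) * T.iota r) = T.q v (T.q w r) := by
      rw [h, map_add, map_add, eps_mu hL, Gen.eps_val, T.eps_iota, add_zero, zero_add]
    rw [h', h]
  | add x y hx hy =>
    simp only [map_add, add_mul]
    nth_rw 1 [hx, hy]
    abel

/-- In `v(wr)` the component of `wr` in `V` contributes nothing to `eps`, which leaves `q(v, q(w,
r))`. -/
theorem qtilde_qhat (r : R) (t : T.Gen ⊗[ℤ] T.Gen) :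
    T.qtilde (T.qhat r) t = T.eps (T.mu t * T.iota r) := by
  induction t with
  | zero => simp
  | tmul v w =>
    rw [qtilde_tmul, qhat_apply, mu_tmul, mul_assoc, val_mul_iota, mul_add, map_add,
      hL _ _ (Gen.eps_val _), zero_add]; rfl
  | add x y hx hy => rw [map_add, map_add, add_mul, map_add, hx, hy]

/-- Since the curvature is zero, `p t` is the product itself, so both terms of the form equal `eps
(T.mu t * T.iota r)`. This is what makes `d² = 0` on `R`. -/
theorem differentialForm_qhat (r : R) (t : T.liftedRelations) :
    T.differentialForm (T.qhat r) t = 0 := by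
  rw [differentialForm, qhat_apply, q, val_p hL, qtilde_qhat hL, sub_self]

/-- In `mu_mul_iota` all terms except the translated product lie in `F₁ A`. It follows that `I_A` is
stable under the right action of `R`. -/
theorem translate_mem (r : R) {t : T.Gen ⊗[ℤ] T.Gen} (ht : t ∈ T.liftedRelations) :
    T.translate r t ∈ T.liftedRelations := by
  refine (T.grMul_proj_eq_zero _).2 ?_
  have h := mu_mul_iota hL r t
  have h' : T.mu (T.translate r t) = T.mu t * T.iota r - (T.contractQ r t).val -
      T.iota (T.eps (T.mu t * T.iota r)) := by
    nth_rw 1 [h]; abel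
  rw [h']
  exact sub_mem (sub_mem (T.mul_iota_mem (T.mu_mem ⟨t, ht⟩)) (Gen.val_mem _))
    (T.mem_one_of_mem_zero (T.iota_mem _))

theorem translate_mem_relations (r : R) {z : BalTensor R T.Gen T.Gen} (hz : z ∈ T.relations) :
    LeftDual.translate r z ∈ T.relations := by
  obtain ⟨t, rfl⟩ := BalTensor.proj_surjective R z
  rw [← proj_translate]
  exact translate_mem hL r (t := t) hz

/-- The counterpart of `differentialForm_op_smul` for the left action, that is, the shadow of `d(rψ)
= q̂(r)ψ + r dψ`. -/
theorem differentialForm_smul (r : R) (ψ : LeftDual R T.Gen) (t : T.liftedRelations) :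
    T.differentialForm (r • ψ) t = T.differentialForm ψ ⟨T.translate r t, translate_mem hL r t.2⟩ +
      LeftDual.pairing (BalTensor.tmul R (T.qhat r) ψ)
        (BalTensor.proj R (t : T.Gen ⊗[ℤ] T.Gen)) := by
  have h₁ : ∀ t, T.qtilde (r • ψ) t = T.qtilde ψ (T.translate r t) := fun t => by
    induction t with
    | zero => simp
    | tmul v w => rfl
    | add x y hx hy => rw [map_add, map_add, map_add, hx, hy]
  have h₂ : ∀ t, LeftDual.pairing (BalTensor.tmul R (T.qhat r) ψ) (BalTensor.proj R t) =
      ψ (T.contractQ r t) := fun t => by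
    induction t with
    | zero => simp
    | tmul v w => rfl
    | add x y hx hy => rw [map_add, map_add, map_add, map_add, hx, hy]
  -- The component of `mu_mul_iota` in `V`, with the product of `t` identified with `p t`.
  have h₃ : op r • T.p t = T.p ⟨T.translate r t, translate_mem hL r t.2⟩ + T.contractQ r t := by
    refine Gen.val_injective ?_
    rw [Gen.val_op_smul, map_add, val_p hL, val_p hL, sub_eq_iff_eq_add]
    exact mu_mul_iota hL r t
  rw [differentialForm, differentialForm, h₁, h₂, LeftDual.smul_apply, h₃, map_add]
  abel

end leftAugmentation

end SplitFilteredRing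

/-- A finitely generated projective module has a finite dual basis. -/
theorem Module.exists_finite_dual_family (K M : Type*) [Ring K] [AddCommGroup M] [Module K M]
    [Module.Finite K M] [Module.Projective K M] :
    ∃ (n : ℕ) (x : Fin n → M) (x' : Fin n → M →ₗ[K] K), ∀ m, ∑ i, x' i m • x i = m := by
  obtain ⟨n, f, g, -, -, h⟩ := Module.Finite.exists_comp_eq_id_of_projective K M
  refine ⟨n, fun i => f (Pi.single i 1), fun i => LinearMap.proj i ∘ₗ g, fun m => ?_⟩
  conv_rhs => rw [← LinearMap.id_apply (R := K) m, ← h, LinearMap.comp_apply,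
    pi_eq_sum_univ' (g m), map_sum]
  refine Finset.sum_congr rfl fun i _ => ?_
  rw [← map_smul]
  congr 1

/-- A linear map which vanishes on the kernel of a surjective linear map factors through it. -/
theorem LinearMap.exists_factor_of_ker_le {K M N P : Type*} [Ring K] [AddCommGroup M] [Module K M]
    [AddCommGroup N] [Module K N] [AddCommGroup P] [Module K P] (p : M →ₗ[K] N)
    (hp : Function.Surjective p) (f : M →ₗ[K] P) (h : ∀ m, p m = 0 → f m = 0) :
    ∃ g : N →ₗ[K] P, ∀ m, g (p m) = f m := by
  refine ⟨(LinearMap.ker p).liftQ f (fun m hm => h m hm) ∘ₗ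
    (p.quotKerEquivOfSurjective hp).symm.toLinearMap, fun m => ?_⟩
  have : (p.quotKerEquivOfSurjective hp).symm (p m) = Submodule.Quotient.mk m := by
    rw [LinearEquiv.symm_apply_eq]; rfl
  rw [LinearMap.comp_apply, LinearEquiv.coe_coe, this]
  exact Submodule.liftQ_apply _ _ _

/-! ### Rings `R ⊗_K C`: the augmentation, `V` and its dual. -/

namespace GradedSquare

variable {S : GradedSquare} {hA : Function.Bijective S.mulMap} {hF : S.IsFiltered}

/-! ### The left augmentation -/

theorem epsC_mul (c c' : S.C) : S.epsC (c * c') = S.epsC c * S.epsC c' := S.etaC_injective (by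
  rw [map_mul S.etaC]
  exact (S.etaC_epsCFun _).trans ((map_mul (GradedRing.projZeroRingHom S.gr) c c').trans
    (congrArg₂ _ (S.etaC_epsCFun c).symm (S.etaC_epsCFun c').symm)))

theorem epsC_etaC (k : S.K) : S.epsC (S.etaC k) = k := S.etaC_injective
  ((S.etaC_epsCFun _).trans (DirectSum.decompose_of_mem_same S.gr (S.etaC_mem k)))

theorem epsC_val (w : S.W) : S.epsC w.val = 0 := S.etaC_injective (by
  rw [map_zero]
  exact (S.etaC_epsCFun _).trans (DirectSum.decompose_of_mem_ne S.gr w.val_mem one_ne_zero))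

theorem projW_val (w : S.W) : S.projW w.val = w :=
  W.val_injective (DirectSum.decompose_of_mem_same S.gr w.val_mem)

theorem projW_mul_val (c : S.C) (w : S.W) : S.projW (c * w.val) = S.epsC c • w :=
  W.val_injective (by
    rw [W.val_smul]
    refine (DirectSum.coe_decompose_mul_add_of_right_mem S.gr (i := 0) w.val_mem).trans ?_
    exact congrArg (· * w.val) (S.etaC_epsCFun c).symm)

/-- Induction over the products `r c` which generate `A`. -/
theorem induction_A (hA : Function.Bijective S.mulMap) {p : S.A → Prop} (a : S.A)
    (ht : ∀ r c, p (S.iota r * S.kappa c)) (ha : ∀ x y, p x → p y → p (x + y)) : p a := by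
  obtain ⟨t, rfl⟩ := hA.2 a
  induction t using BalTensor.induction_on with
  | h0 => simpa using ht 0 0
  | ht r c => exact ht r c
  | ha x y hx hy => rw [map_add]; exact ha _ _ hx hy

/-- On `a = sc'` both sides are `s` times the image of `ε(c')θ(c)`. The hypothesis on `θ` holds for
`ε_C` and any `c`, and for `φ ∘ projW` and `c` in `W`. -/
theorem extend_mul_kappa_of_mul (hA : Function.Bijective S.mulMap) (θ : S.C →ₗ[S.K] S.K) (c : S.C)
    (h : ∀ c', θ (c' * c) = S.epsC c' * θ c) (a : S.A) :
    S.extend hA θ (a * S.kappa c) = S.extend hA S.epsC (a * S.iota (S.etaR (θ c))) := by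
  induction a using induction_A hA with
  | ht s c' =>
    rw [S.comm, mul_assoc, mul_assoc, ← map_mul, ← map_mul, extend_mul_kappa, extend_mul_kappa, h,
      epsC_mul, epsC_etaC]
  | ha x y hx hy => rw [add_mul, add_mul, map_add, map_add, hx, hy]

/-- For `x = rc` this is the preceding identity with `θ = ε_C`, applied to `ar` and `c`. -/
theorem eps_mul_eq (a x : S.A) :
    S.extend hA S.epsC (a * x) = S.extend hA S.epsC (a * S.iota (S.extend hA S.epsC x)) := by
  induction x using induction_A hA with
  | ht r c =>
    rw [← mul_assoc, extend_mul_kappa_of_mul hA _ _ fun c' => epsC_mul c' c, extend_mul_kappa,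
      mul_assoc, ← map_mul]
  | ha x y hx hy => rw [mul_add, map_add, hx, hy, map_add, map_add, mul_add, map_add]

theorem isLeftAugmentation : (S.filteredRing hA hF).IsLeftAugmentation := by
  intro a x hx
  change S.extend hA S.epsC x = 0 at hx
  change S.extend hA S.epsC (a * x) = 0
  rw [eps_mul_eq, hx, map_zero, mul_zero, map_zero]

/-! ### The bimodule `V` -/

variable (hA hF) in
/-- The inclusion `W → V`. -/
def inclW : S.W →+ (S.filteredRing hA hF).Gen :=
  AddMonoidHom.mk' (fun w => ⟨S.kappa w.val, AddSubgroup.subset_closure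
      ⟨1, 1, le_rfl, w.val, w.val_mem, by rw [map_one, one_mul]⟩, by
    change S.extend hA S.epsC _ = 0
    have h := extend_mul_kappa hA S.epsC 1 w.val
    rwa [map_one, one_mul, one_mul, epsC_val, map_zero] at h⟩)
    fun w w' => Subtype.ext (by
      change S.kappa (W.val (w + w')) = S.kappa w.val + S.kappa w'.val
      rw [map_add, map_add])

@[simp] theorem val_inclW (w : S.W) : (inclW hA hF w).val = S.kappa w.val := rfl

theorem inclW_smul (k : S.K) (w : S.W) : inclW hA hF (k • w) = S.etaR k • inclW hA hF w :=
  SplitFilteredRing.Gen.val_injective (by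
    rw [SplitFilteredRing.Gen.val_smul, val_inclW, val_inclW, W.val_smul, map_mul, ← S.comm]
    rfl)

theorem inclW_op_smul (k : S.K) (w : S.W) :
    inclW hA hF (op k • w) = op (S.etaR k) • inclW hA hF w :=
  SplitFilteredRing.Gen.val_injective (by
    have h : (inclW hA hF (op k • w)).val = (inclW hA hF w).val * S.iota (S.etaR k) := by
      rw [val_inclW, val_inclW, W.val_op_smul, map_mul, S.comm]
    -- The product of `w` and `k` stays in `W`, hence in `ker eps`: for scalars from `K` the right
    -- action on `W` needs no correction.
    have h' : (S.filteredRing hA hF).eps ((inclW hA hF w).val * S.iota (S.etaR k)) = 0 := by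
      rw [← h, SplitFilteredRing.Gen.eps_val]
    rw [SplitFilteredRing.Gen.val_op_smul, h]
    change _ = _ - S.iota ((S.filteredRing hA hF).eps ((inclW hA hF w).val * S.iota (S.etaR k)))
    rw [h', map_zero, sub_zero]
    rfl)

variable (hA hF) in
/-- The map `R ⊗_K W → V`. -/
def tensorW : BalTensor S.K S.R S.W →+ (S.filteredRing hA hF).Gen :=
  BalTensor.liftFun S.K (fun r w => r • inclW hA hF w) (fun r r' w => add_smul _ _ _)
    (fun r w w' => by rw [map_add, smul_add])
    (fun r k w => by rw [inclW_smul, smul_smul]; rfl)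

theorem val_tensorW_tmul (r : S.R) (w : S.W) :
    (tensorW hA hF (BalTensor.tmul S.K r w)).val = S.iota r * S.kappa w.val := rfl

theorem tensorW_surjective : Function.Surjective (tensorW hA hF) := by
  -- The splitting `F₁ A = R ⊕ RW`, with `eps` giving the first component; on `V` that component is
  -- zero.
  have key : ∀ a ∈ S.filtration 1, ∃ t,
      a = S.iota (S.extend hA S.epsC a) + (tensorW hA hF t).val := by
    intro a ha
    refine AddSubgroup.closure_induction (p := fun a _ => ∃ t,
      a = S.iota (S.extend hA S.epsC a) + (tensorW hA hF t).val) ?_ ?_ ?_ ?_ ha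
    · rintro _ ⟨r, i, hi, c, hc, rfl⟩
      rw [extend_mul_kappa]
      interval_cases i
      · rw [S.gr_zero] at hc
        obtain ⟨k, rfl⟩ := hc
        refine ⟨0, ?_⟩
        change S.iota r * S.kappa (S.etaC k) = S.iota (r * S.etaR (S.epsC (S.etaC k))) + _
        rw [epsC_etaC, map_zero, map_zero, add_zero, map_mul, S.comm]
      · obtain ⟨w, rfl⟩ : ∃ w : S.W, w.val = c := ⟨⟨c, hc⟩, rfl⟩
        refine ⟨BalTensor.tmul S.K r w, ?_⟩
        rw [val_tensorW_tmul, epsC_val, map_zero, mul_zero, map_zero, zero_add]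
    · exact ⟨0, by simp⟩
    · rintro x y - - ⟨s, hs⟩ ⟨t, ht⟩
      refine ⟨s + t, ?_⟩
      rw [map_add, map_add, map_add, map_add]
      nth_rw 1 [hs, ht]; abel
    · rintro x - ⟨s, hs⟩
      refine ⟨-s, ?_⟩
      rw [map_neg, map_neg, map_neg, map_neg]
      nth_rw 1 [hs]; abel
  intro v
  obtain ⟨t, ht⟩ := key v.val v.val_mem
  have hv : S.extend hA S.epsC v.val = 0 := v.eps_val
  rw [hv, map_zero, zero_add] at ht
  exact ⟨t, SplitFilteredRing.Gen.val_injective ht.symm⟩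

/-- A left inverse is the inclusion of `V` in `A ≅ R ⊗_K C` followed by the projection of `C` to
`C₁`. -/
theorem tensorW_injective : Function.Injective (tensorW hA hF) := by
  let P : BalTensor S.K S.R S.C →+ BalTensor S.K S.R S.W :=
    BalTensor.liftFun S.K (fun r c => BalTensor.tmul S.K r (S.projW c))
      (fun _ _ _ => BalTensor.add_tmul _ _ _) (fun _ _ _ => by rw [map_add, BalTensor.tmul_add])
      (fun _ _ _ => by rw [BalTensor.balanced, map_smul])
  let Q : S.A →+ BalTensor S.K S.R S.W :=
    P.comp (AddEquiv.ofBijective S.mulMap hA).symm.toAddMonoidHom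
  have h : (Q.comp SplitFilteredRing.Gen.val).comp (tensorW hA hF) = AddMonoidHom.id _ := by
    refine BalTensor.hom_ext fun r w => ?_
    change P ((AddEquiv.ofBijective S.mulMap hA).symm (S.mulMap (BalTensor.tmul S.K r w.val))) = _
    have h' : (AddEquiv.ofBijective S.mulMap hA).symm (S.mulMap (BalTensor.tmul S.K r w.val)) =
        BalTensor.tmul S.K r w.val :=
      (AddEquiv.ofBijective S.mulMap hA).symm_apply_apply (BalTensor.tmul S.K r w.val)
    rw [h', BalTensor.liftFun_tmul, projW_val]; rfl
  exact Function.LeftInverse.injective (g := Q.comp SplitFilteredRing.Gen.val)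
    fun t => DFunLike.congr_fun h t

/-- Induction over the products `r w` which generate `V`. -/
@[elab_as_elim]
theorem induction_Gen {p : (S.filteredRing hA hF).Gen → Prop} (v : (S.filteredRing hA hF).Gen)
    (ht : ∀ (r : S.R) w, p (r • inclW hA hF w)) (ha : ∀ x y, p x → p y → p (x + y)) : p v := by
  obtain ⟨t, rfl⟩ := tensorW_surjective v
  induction t using BalTensor.induction_on with
  | h0 => simpa using ht 0 0
  | ht r w => exact ht r w
  | ha x y hx hy => rw [map_add]; exact ha _ _ hx hy

theorem leftDual_ext {f g : LeftDual S.R (S.filteredRing hA hF).Gen}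
    (h : ∀ w, f (inclW hA hF w) = g (inclW hA hF w)) : f = g := LeftDual.ext fun v => by
  induction v using induction_Gen with
  | ht r w => rw [LeftDual.map_smul, LeftDual.map_smul, h]
  | ha x y hx hy => rw [map_add, map_add, hx, hy]

/-- Two additive maps on `V ⊗_R V` which agree on `r w ⊗ w'` are equal. -/
theorem hom_ext_Gen {P : Type*} [AddCommGroup P]
    {f g : BalTensor S.R (S.filteredRing hA hF).Gen (S.filteredRing hA hF).Gen →+ P}
    (h : ∀ (r : S.R) w w', f (BalTensor.tmul S.R (r • inclW hA hF w) (inclW hA hF w')) =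
      g (BalTensor.tmul S.R (r • inclW hA hF w) (inclW hA hF w'))) : f = g := by
  have h' : ∀ v w', f (BalTensor.tmul S.R v (inclW hA hF w')) =
      g (BalTensor.tmul S.R v (inclW hA hF w')) := fun v w' => by
    induction v using induction_Gen with
    | ht r w => exact h r w w'
    | ha x y hx hy => rw [BalTensor.add_tmul, map_add, map_add, hx, hy]
  refine BalTensor.hom_ext fun v u => ?_
  induction u using induction_Gen with
  -- The scalar of the second factor moves to the first, leaving an element of `W` on the right.
  | ht s w' => rw [← BalTensor.balanced]; exact h' _ _
  | ha x y hx hy => rw [BalTensor.tmul_add, map_add, map_add, hx, hy]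

/-! ### The left dual of `V` -/

theorem extendDual_inclW (φ : LeftDual S.K S.W) (w : S.W) :
    S.extendDual hA hF φ (inclW hA hF w) = S.etaR (φ w) := by
  change S.extend hA _ (S.kappa w.val) = _
  rw [← one_mul (S.kappa w.val), ← map_one S.iota, extend_mul_kappa, one_mul]
  change S.etaR (φ (S.projW w.val)) = _
  rw [projW_val]

theorem extendDual_smul_inclW (φ : LeftDual S.K S.W) (r : S.R) (w : S.W) :
    S.extendDual hA hF φ (r • inclW hA hF w) = r * S.etaR (φ w) := by
  rw [LeftDual.map_smul, extendDual_inclW]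

theorem extendDual_add (φ φ' : LeftDual S.K S.W) :
    S.extendDual hA hF (φ + φ') = S.extendDual hA hF φ + S.extendDual hA hF φ' :=
  leftDual_ext fun w => by
    simp only [LeftDual.add_apply, extendDual_inclW, map_add]

theorem extendDual_op_smul (k : S.K) (φ : LeftDual S.K S.W) :
    S.extendDual hA hF (op k • φ) = op (S.etaR k) • S.extendDual hA hF φ :=
  leftDual_ext fun w => by
    simp only [LeftDual.op_smul_apply, extendDual_inclW, map_mul]

theorem extendDual_smul (k : S.K) (φ : LeftDual S.K S.W) :
    S.extendDual hA hF (k • φ) = S.etaR k • S.extendDual hA hF φ :=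
  leftDual_ext fun w => by
    rw [LeftDual.smul_apply, extendDual_inclW, LeftDual.smul_apply, ← inclW_op_smul,
      extendDual_inclW]

variable (hA hF) in
/-- The map `Hom_K(W, K) ⊗_K R → Hom_R(V, R)`. -/
def tensorDual : BalTensor S.K (LeftDual S.K S.W) S.R →+
    LeftDual S.R (S.filteredRing hA hF).Gen :=
  BalTensor.liftFun S.K (fun φ r => op r • S.extendDual hA hF φ)
    (fun φ φ' r => by rw [extendDual_add, smul_add])
    (fun φ r r' => by rw [op_add, add_smul])
    (fun φ k r => by rw [extendDual_op_smul, ← mul_smul, smul_R, op_mul])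

theorem tensorDual_tmul (φ : LeftDual S.K S.W) (r : S.R) :
    tensorDual hA hF (BalTensor.tmul S.K φ r) = op r • S.extendDual hA hF φ := rfl

/-- A dual basis of `W` over `K` remains one of `V` over `R`, by left linearity. -/
theorem sum_extendDual_smul {ι : Type*} [Fintype ι] {x : ι → S.W} {x' : ι → LeftDual S.K S.W}
    (hx : ∀ w, ∑ i, x' i w • x i = w) (v : (S.filteredRing hA hF).Gen) :
    ∑ i, S.extendDual hA hF (x' i) v • inclW hA hF (x i) = v := by
  induction v using induction_Gen with
  | ht r w =>
    conv_rhs => rw [← hx w, map_sum, Finset.smul_sum]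
    refine Finset.sum_congr rfl fun i _ => ?_
    rw [extendDual_smul_inclW, mul_smul, inclW_smul]
  | ha u v hu hv =>
    conv_rhs => rw [← hu, ← hv, ← Finset.sum_add_distrib]
    exact Finset.sum_congr rfl fun i _ => by rw [map_add, add_smul]

theorem exists_dual_family (hP : S.IsLeftFGProjective) :
    ∃ (n : ℕ) (x : Fin n → S.W) (x' : Fin n → LeftDual S.K S.W), ∀ w, ∑ i, x' i w • x i = w := by
  have := (hP 1).1
  have := (hP 1).2
  exact Module.exists_finite_dual_family S.K (S.comp 1)

/-- The inverse is `ψ ↦ ∑ x' i ⊗ ψ(x i)`, for a dual basis of `W`. -/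
theorem tensorDual_bijective (hP : S.IsLeftFGProjective) :
    Function.Bijective (tensorDual hA hF) := by
  obtain ⟨n, x, x', hx⟩ := exists_dual_family hP
  let Q : LeftDual S.R (S.filteredRing hA hF).Gen → BalTensor S.K (LeftDual S.K S.W) S.R :=
    fun ψ => ∑ i, BalTensor.tmul S.K (x' i) (ψ (inclW hA hF (x i)))
  have hl : Function.LeftInverse Q (tensorDual hA hF) := fun t => by
    induction t using BalTensor.induction_on with
    | h0 =>
      refine Finset.sum_eq_zero fun i _ => ?_
      rw [map_zero, LeftDual.zero_apply]
      exact map_zero (BalTensor.tmulRight S.K (x' i))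
    | ht φ r =>
      conv_rhs => rw [← LeftDual.sum_op_smul hx φ, BalTensor.sum_tmul]
      refine Finset.sum_congr rfl fun i _ => ?_
      rw [tensorDual_tmul, LeftDual.op_smul_apply, extendDual_inclW, BalTensor.balanced]; rfl
    | ha s t hs ht =>
      conv_rhs => rw [← hs, ← ht]
      simp only [Q]
      rw [map_add, ← Finset.sum_add_distrib]
      exact Finset.sum_congr rfl fun i _ => by rw [LeftDual.add_apply, BalTensor.tmul_add]
  have hr : Function.RightInverse Q (tensorDual hA hF) := fun ψ => by
    simp only [Q]
    rw [map_sum]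
    exact LeftDual.sum_op_smul (sum_extendDual_smul hx) ψ
  exact ⟨hl.injective, hr.surjective⟩

/-- Induction over the products `φ r` which generate `Hom_R(V, R)`. -/
theorem induction_leftDual (hP : S.IsLeftFGProjective)
    {p : LeftDual S.R (S.filteredRing hA hF).Gen → Prop}
    (ψ : LeftDual S.R (S.filteredRing hA hF).Gen)
    (ht : ∀ φ (r : S.R), p (op r • S.extendDual hA hF φ)) (ha : ∀ x y, p x → p y → p (x + y)) : p ψ := by
  obtain ⟨t, rfl⟩ := (tensorDual_bijective hP).2 ψ
  induction t using BalTensor.induction_on with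
  | h0 => simpa using ht 0 0
  | ht φ r => exact ht φ r
  | ha x y hx hy => rw [map_add]; exact ha _ _ hx hy

end GradedSquare

/-! ### Degree two and the comparison of `C^⊥` with the dual of `A`. -/

namespace GradedSquare

variable {S : GradedSquare} {hA : Function.Bijective S.mulMap} {hF : S.IsFiltered}

/-! ### The component `C₂` -/

variable (S) in
/-- The projection `C → C₂`. -/
def projTwo : S.C →ₗ[S.K] S.comp 2 where
  toFun c := ⟨DirectSum.decompose S.gr c 2, SetLike.coe_mem (DirectSum.decompose S.gr c 2)⟩
  map_add' c c' := Subtype.ext (by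
    change (DirectSum.decompose S.gr (c + c') 2 : S.C) =
      DirectSum.decompose S.gr c 2 + DirectSum.decompose S.gr c' 2
    rw [DirectSum.decompose_add]; rfl)
  map_smul' k c := Subtype.ext (S.decompose_smul k c 2)

theorem projTwo_of_mem {c : S.C} (hc : c ∈ S.gr 2) : S.projTwo c = ⟨c, hc⟩ :=
  Subtype.ext (DirectSum.decompose_of_mem_same S.gr hc)

theorem projTwo_of_mem_ne {c : S.C} {n : ℕ} (hc : c ∈ S.gr n) (hn : n ≠ 2) : S.projTwo c = 0 :=
  Subtype.ext (DirectSum.decompose_of_mem_ne S.gr hc hn)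

theorem mulW_tmul (w w' : S.W) : S.mulW (BalTensor.tmul S.K w w') = w.val * w'.val := rfl

theorem mulW_mem (z : BalTensor S.K S.W S.W) : S.mulW z ∈ S.gr 2 := by
  induction z using BalTensor.induction_on with
  | h0 => rw [map_zero]; exact zero_mem _
  | ht w w' => exact SetLike.GradedMul.mul_mem w.val_mem w'.val_mem
  | ha x y hx hy => rw [map_add]; exact add_mem hx hy

variable (S) in
/-- The product `W ⊗_K W → C₂`. -/
def mulTwo : BalTensor S.K S.W S.W →ₗ[S.K] S.comp 2 where
  toFun z := ⟨S.mulW z, mulW_mem z⟩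
  map_add' z z' := Subtype.ext (map_add S.mulW z z')
  map_smul' k z := Subtype.ext (by
    change S.mulW (k • z) = S.etaC k * S.mulW z
    induction z using BalTensor.induction_on with
    | h0 => simp
    | ht w w' => exact mul_assoc _ _ _
    | ha x y hx hy => rw [smul_add, map_add, map_add, mul_add, hx, hy])

theorem projTwo_mul (w w' : S.W) :
    S.projTwo (w.val * w'.val) = S.mulTwo (BalTensor.tmul S.K w w') :=
  projTwo_of_mem (mulW_mem (BalTensor.tmul S.K w w'))

theorem mulTwo_eq_zero {z : BalTensor S.K S.W S.W} : S.mulTwo z = 0 ↔ z ∈ S.relationsC :=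
  Subtype.ext_iff

theorem mulW_mul_etaC (z : BalTensor S.K S.W S.W) (k : S.K) :
    ∃ z', S.mulW z' = S.mulW z * S.etaC k := by
  induction z using BalTensor.induction_on with
  | h0 => exact ⟨0, by simp⟩
  | ht w w' => exact ⟨BalTensor.tmul S.K w (op k • w'), (mul_assoc _ _ _).symm⟩
  | ha x y hx hy =>
    obtain ⟨x', hx⟩ := hx
    obtain ⟨y', hy⟩ := hy
    exact ⟨x' + y', by rw [map_add, map_add, add_mul, hx, hy]⟩

/-- `C` is generated by `W` over `K`, so the degree two component of any element is a sum of
products of two elements of `W`. -/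
theorem mulTwo_surjective (hC : S.IsHomogeneousQuadratic) : Function.Surjective S.mulTwo := by
  obtain ⟨f, hb, hg, -, hf⟩ := hC
  have key : ∀ b, ∃ z, S.mulW z = DirectSum.decompose S.gr (f b) 2 := fun b => by
    induction b using QuadraticRing.induction_mul with
    | h1 =>
      refine ⟨0, ?_⟩
      rw [map_zero, map_one, DirectSum.decompose_of_mem_ne S.gr SetLike.GradedOne.one_mem
        (by norm_num)]
    | hb x k hx =>
      obtain ⟨z, hz⟩ := hx
      obtain ⟨z', hz'⟩ := mulW_mul_etaC z k
      refine ⟨z', ?_⟩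
      rw [map_mul, hb, DirectSum.coe_decompose_mul_of_right_mem_zero S.gr (S.etaC_mem k), ← hz, hz']
    | hg x w hx =>
      -- Only the degree one component of `f x` contributes to degree two after multiplication by
      -- `w`.
      refine ⟨BalTensor.tmul S.K (S.projW (f x)) w, ?_⟩
      rw [map_mul, hg]
      exact (DirectSum.coe_decompose_mul_add_of_right_mem S.gr (i := 1) w.val_mem).symm
    | ha x y hx hy =>
      obtain ⟨x', hx⟩ := hx
      obtain ⟨y', hy⟩ := hy
      exact ⟨x' + y', by rw [map_add, map_add, DirectSum.decompose_add, hx, hy]; rfl⟩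
  rintro ⟨c, hc⟩
  obtain ⟨b, rfl⟩ := hf c
  obtain ⟨z, hz⟩ := key b
  exact ⟨z, Subtype.ext (hz.trans (DirectSum.decompose_of_mem_same S.gr hc))⟩

/-! ### The quadratic relations of the dual -/

variable (hA hF) in
/-- The map `W ⊗_K W → V ⊗_R V`. -/
def inclWW : BalTensor S.K S.W S.W →+
    BalTensor S.R (S.filteredRing hA hF).Gen (S.filteredRing hA hF).Gen :=
  BalTensor.liftFun S.K (fun w w' => BalTensor.tmul S.R (inclW hA hF w) (inclW hA hF w'))
    (fun _ _ _ => by rw [map_add, BalTensor.add_tmul])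
    (fun _ _ _ => by rw [map_add, BalTensor.tmul_add])
    (fun w k w' => by rw [inclW_op_smul, inclW_smul, BalTensor.balanced])

theorem inclWW_tmul (w w' : S.W) : inclWW hA hF (BalTensor.tmul S.K w w') =
    BalTensor.tmul S.R (inclW hA hF w) (inclW hA hF w') := rfl

theorem inclWW_smul (k : S.K) (z : BalTensor S.K S.W S.W) :
    inclWW hA hF (k • z) = S.etaR k • inclWW hA hF z := by
  induction z using BalTensor.induction_on with
  | h0 => simp
  | ht w w' =>
    rw [BalTensor.smul_tmul, inclWW_tmul, inclWW_tmul, BalTensor.smul_tmul, inclW_smul]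
  | ha x y hx hy => rw [smul_add, map_add, map_add, smul_add, hx, hy]

theorem grMul_inclWW (z : BalTensor S.K S.W S.W) :
    (S.filteredRing hA hF).grMul (inclWW hA hF z) =
      QuotientAddGroup.mk' ((S.filteredRing hA hF).F 1) (S.kappa (S.mulW z)) := by
  induction z using BalTensor.induction_on with
  | h0 => simp
  | ht w w' => rw [mulW_tmul, map_mul]; rfl
  | ha x y hx hy => rw [map_add, map_add, map_add, map_add, map_add, hx, hy]

variable (hA hF) in
/-- The map `φ ⊗ φ' ↦ φ ⊗ φ' r` from `W^∨ ⊗_K W^∨` to `V^∨ ⊗_R V^∨`. -/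
def extendDual₂ (r : S.R) : BalTensor S.K (LeftDual S.K S.W) (LeftDual S.K S.W) →+
    BalTensor S.R (LeftDual S.R (S.filteredRing hA hF).Gen)
      (LeftDual S.R (S.filteredRing hA hF).Gen) :=
  BalTensor.liftFun S.K
    (fun φ φ' => BalTensor.tmul S.R (S.extendDual hA hF φ) (op r • S.extendDual hA hF φ'))
    (fun _ _ _ => by rw [extendDual_add, BalTensor.add_tmul])
    (fun _ _ _ => by rw [extendDual_add, smul_add, BalTensor.tmul_add])
    (fun φ k φ' => by
      rw [extendDual_op_smul, extendDual_smul, BalTensor.balanced, smul_comm])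

theorem extendDual₂_tmul (r : S.R) (φ φ' : LeftDual S.K S.W) :
    extendDual₂ hA hF r (BalTensor.tmul S.K φ φ') =
      BalTensor.tmul S.R (S.extendDual hA hF φ) (op r • S.extendDual hA hF φ') := rfl

theorem pairing_extendDual₂ (s : S.R) (t : BalTensor S.K (LeftDual S.K S.W) (LeftDual S.K S.W))
    (r : S.R) (w w' : S.W) :
    LeftDual.pairing (extendDual₂ hA hF s t)
        (BalTensor.tmul S.R (r • inclW hA hF w) (inclW hA hF w')) =
      r * S.etaR (LeftDual.pairing t (BalTensor.tmul S.K w w')) * s := by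
  induction t using BalTensor.induction_on with
  | h0 => simp
  | ht φ φ' =>
    rw [extendDual₂_tmul, LeftDual.pairing_tmul, LeftDual.pairing_tmul, LeftDual.op_smul_apply,
      extendDual_inclW, ← smul_comm, ← inclW_op_smul, extendDual_smul_inclW]
  | ha x y hx hy =>
    rw [map_add, map_add, AddMonoidHom.add_apply, hx, hy, map_add, AddMonoidHom.add_apply, map_add,
      mul_add, add_mul]

/-- An element of `I_C^⊥` is, as an element of `V^∨ ⊗_R V^∨`, in `I_A^⊥`. -/
theorem extendDual₂_mem (hC : S.IsHomogeneousQuadratic)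
    {t : BalTensor S.K (LeftDual S.K S.W) (LeftDual S.K S.W)}
    (ht : t ∈ LeftDual.annihilator S.relationsC) :
    extendDual₂ hA hF 1 t ∈ (S.filteredRing hA hF).dualRelations := by
  -- As `t` kills `I_C`, it is a functional `ξ` on `C₂`; its extension `θ` to `A` kills `F₁ A`, and
  -- the product followed by `θ` is the pairing with the image of `t`. So that image vanishes on
  -- `I_A`.
  obtain ⟨ξ, hξ⟩ := LinearMap.exists_factor_of_ker_le S.mulTwo (mulTwo_surjective hC)
    (LeftDual.pairingₗ t) (fun z hz => ht z (mulTwo_eq_zero.1 hz))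
  let θ : S.A →+ S.R := S.extend hA (ξ ∘ₗ S.projTwo)
  have hθ : (S.filteredRing hA hF).F 1 ≤ θ.ker := by
    change S.filtration 1 ≤ _
    rw [filtration, AddSubgroup.closure_le]
    rintro _ ⟨r, i, hi, c, hc, rfl⟩
    change S.extend hA _ _ = 0
    rw [extend_mul_kappa, LinearMap.comp_apply, projTwo_of_mem_ne hc (by lia), map_zero, map_zero,
      mul_zero]
  have h : LeftDual.pairing (extendDual₂ hA hF 1 t) =
      (QuotientAddGroup.lift _ θ hθ).comp (S.filteredRing hA hF).grMul := by
    refine hom_ext_Gen fun r w w' => ?_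
    rw [pairing_extendDual₂, mul_one]
    change _ = S.extend hA _ (S.iota r * S.kappa w.val * S.kappa w'.val)
    rw [mul_assoc, ← map_mul, extend_mul_kappa, LinearMap.comp_apply, projTwo_mul, hξ]
    rfl
  intro z hz
  have hz' : (S.filteredRing hA hF).grMul z = 0 := hz
  rw [h, AddMonoidHom.comp_apply, hz', map_zero]

/-- `I_A^⊥` is generated by `I_C^⊥` as a right `R`-module. -/
theorem mem_closure_of_mem_dualRelations (hC : S.IsHomogeneousQuadratic)
    (hP : S.IsLeftFGProjective)
    {t : BalTensor S.R (LeftDual S.R (S.filteredRing hA hF).Gen)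
      (LeftDual S.R (S.filteredRing hA hF).Gen)}
    (ht : t ∈ (S.filteredRing hA hF).dualRelations) :
    t ∈ AddSubgroup.closure {t | ∃ (r : S.R), ∃ t' ∈ LeftDual.annihilator S.relationsC,
      t = extendDual₂ hA hF r t'} := by
  obtain ⟨n, x, x', hx⟩ := exists_dual_family hP
  have := (hP 2).1
  have := (hP 2).2
  obtain ⟨m, c, c', hc⟩ := Module.exists_finite_dual_family S.K (S.comp 2)
  -- The restriction of `t` to `W ⊗_K W`, with values in `R`. It kills `I_C`, whose image lies in
  -- `I_A`, and so becomes a map `g` on `C₂`.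
  let F : BalTensor S.K S.W S.W →ₗ[S.K] S.R :=
    { toFun := fun z => LeftDual.pairing t (inclWW hA hF z)
      map_add' := fun y z => by rw [map_add, map_add]
      map_smul' := fun k z => by
        rw [inclWW_smul, ← LeftDual.pairingₗ_apply, map_smul]; rfl }
  obtain ⟨g, hg⟩ := LinearMap.exists_factor_of_ker_le S.mulTwo (mulTwo_surjective hC) F
    (fun z hz => ht _ (by
      change (S.filteredRing hA hF).grMul _ = 0
      have hz' : S.mulW z = 0 := mulTwo_eq_zero.1 hz
      rw [grMul_inclWW, hz', map_zero, map_zero]))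
  -- The coordinates of `C₂`, pulled back to `W ⊗_K W` and hence in `I_C^⊥`. Expanding `g` in the
  -- dual basis writes `t` as the sum of the `τ i` times `g (c i)`.
  let τ : Fin m → BalTensor S.K (LeftDual S.K S.W) (LeftDual S.K S.W) :=
    fun i => LeftDual.ofFunctional x x' (c' i ∘ₗ S.mulTwo)
  have hτ : ∀ i z, LeftDual.pairing (τ i) z = c' i (S.mulTwo z) :=
    fun i z => LeftDual.pairing_ofFunctional hx _ z
  have h : t = ∑ i, extendDual₂ hA hF (g (c i)) (τ i) := by
    refine LeftDual.pairing_injective (sum_extendDual_smul hx) fun z => ?_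
    refine DFunLike.congr_fun (hom_ext_Gen fun r w w' => ?_) z
    rw [map_sum, AddMonoidHom.finsetSum_apply]
    simp only [pairing_extendDual₂, hτ]
    have hF' : F (BalTensor.tmul S.K w w') =
      LeftDual.pairing t (BalTensor.tmul S.R (inclW hA hF w) (inclW hA hF w')) := rfl
    rw [← BalTensor.smul_tmul, ← LeftDual.pairingₗ_apply, map_smul, LeftDual.pairingₗ_apply, ← hF',
      ← hg, smul_eq_mul]
    conv_lhs => rw [← hc (S.mulTwo _), map_sum, Finset.mul_sum]
    refine Finset.sum_congr rfl fun i _ => ?_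
    rw [map_smul, smul_R, mul_assoc]
  rw [h]
  refine sum_mem fun i _ => AddSubgroup.subset_closure ⟨g (c i), τ i, fun z hz => ?_, rfl⟩
  rw [hτ, mulTwo_eq_zero.2 hz, map_zero]

/-! ### The comparison of the quadratic duals -/

variable (hA hF) in
/-- The ring homomorphism `C^⊥ → (gr^F A)^⊥`. -/
def dualHom (hC : S.IsHomogeneousQuadratic) : S.DualC →+* (S.filteredRing hA hF).Dual :=
  QuadraticRing.lift ((S.filteredRing hA hF).dualBase.comp S.etaR)
    ((S.filteredRing hA hF).dualGen.comp
      (AddMonoidHom.mk' (S.extendDual hA hF) extendDual_add))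
    (fun k φ => by
      change QuadraticRing.gen _ _ _ (S.extendDual hA hF _) = _
      rw [extendDual_smul, QuadraticRing.gen_smul]; rfl)
    (fun k φ => by
      change QuadraticRing.gen _ _ _ (S.extendDual hA hF _) = _
      rw [extendDual_op_smul, QuadraticRing.gen_op_smul]; rfl)
    ((QuadraticRing.gen₂ _ _ _).comp (extendDual₂ hA hF 1))
    (fun φ φ' => by
      rw [AddMonoidHom.comp_apply, extendDual₂_tmul, op_one, one_smul, QuadraticRing.gen₂_tmul]
      rfl)
    (fun t ht => QuadraticRing.gen₂_eq_zero (extendDual₂_mem hC ht))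

@[simp] theorem dualHom_base (hC : S.IsHomogeneousQuadratic) (k : S.K) :
    dualHom hA hF hC (S.dualCBase k) = (S.filteredRing hA hF).dualBase (S.etaR k) :=
  QuadraticRing.lift_base _ _ _ _ _ _ _ k

@[simp] theorem dualHom_gen (hC : S.IsHomogeneousQuadratic) (φ : LeftDual S.K S.W) :
    dualHom hA hF hC (S.dualCGen φ) =
      (S.filteredRing hA hF).dualGen (S.extendDual hA hF φ) :=
  QuadraticRing.lift_gen _ _ _ _ _ _ _ φ

theorem dualHom_sign (hC : S.IsHomogeneousQuadratic) (c : S.DualC) :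
    dualHom hA hF hC (QuadraticRing.sign _ _ _ c) =
      QuadraticRing.sign _ _ _ (dualHom hA hF hC c) := by
  induction c using QuadraticRing.induction_on with
  | hb k => rw [QuadraticRing.sign_base, dualHom_base, QuadraticRing.sign_base]
  | hg φ => rw [QuadraticRing.sign_gen, map_neg, dualHom_gen, QuadraticRing.sign_gen]
  | ha x y hx hy => simp only [map_add, hx, hy]
  | hm x y hx hy => simp only [map_mul, hx, hy]

variable (hA hF) in
/-- The map `C^⊥ ⊗_K R → (gr^F A)^⊥` induced by the product. -/
def dualMul (hC : S.IsHomogeneousQuadratic) :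
    BalTensor S.K S.DualC S.R →+ (S.filteredRing hA hF).Dual :=
  BalTensor.liftFun S.K (fun c r => dualHom hA hF hC c * (S.filteredRing hA hF).dualBase r)
    (fun _ _ _ => by rw [map_add, add_mul]) (fun _ _ _ => by rw [map_add, mul_add])
    (fun c k r => by
      rw [QuadraticRing.op_smul_def, map_mul, dualHom_base, smul_R, map_mul, mul_assoc])

theorem dualMul_tmul (hC : S.IsHomogeneousQuadratic) (c : S.DualC) (r : S.R) :
    dualMul hA hF hC (BalTensor.tmul S.K c r) =
      dualHom hA hF hC c * (S.filteredRing hA hF).dualBase r := rfl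

theorem dualMul_smul (hC : S.IsHomogeneousQuadratic) (c : S.DualC)
    (m : BalTensor S.K S.DualC S.R) :
    dualMul hA hF hC (c • m) = dualHom hA hF hC c * dualMul hA hF hC m := by
  induction m using BalTensor.induction_on with
  | h0 => simp
  | ht c' r =>
    rw [BalTensor.smul_tmul, dualMul_tmul, dualMul_tmul, smul_eq_mul, map_mul, mul_assoc]
  | ha x y hx hy => rw [smul_add, map_add, map_add, hx, hy, mul_add]

/-- The image contains `1` and is closed under right multiplication by generators: `(cs)ψ = c(sψ)`,
and `sψ` is a sum of products `φr`. -/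
theorem dualMul_surjective (hC : S.IsHomogeneousQuadratic) (hP : S.IsLeftFGProjective) :
    Function.Surjective (dualMul hA hF hC) := by
  have hgen : ∀ ψ, (S.filteredRing hA hF).dualGen ψ ∈ (dualMul hA hF hC).range := fun ψ => by
    induction ψ using induction_leftDual hP with
    | ht φ r =>
      refine ⟨BalTensor.tmul S.K (S.dualCGen φ) r, ?_⟩
      rw [dualMul_tmul, dualHom_gen, QuadraticRing.gen_op_smul]
    | ha x y hx hy => rw [map_add]; exact add_mem hx hy
  intro b
  change b ∈ (dualMul hA hF hC).range
  induction b using QuadraticRing.induction_mul with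
  | h1 => exact ⟨BalTensor.tmul S.K 1 1, by rw [dualMul_tmul, map_one, map_one, mul_one]⟩
  | hb x r hx =>
    obtain ⟨m, rfl⟩ := hx
    induction m using BalTensor.induction_on with
    | h0 => rw [map_zero, zero_mul]; exact zero_mem _
    | ht c s => exact ⟨BalTensor.tmul S.K c (s * r), by
        rw [dualMul_tmul, dualMul_tmul, map_mul, mul_assoc]⟩
    | ha x y hx hy => rw [map_add, add_mul]; exact add_mem hx hy
  | hg x ψ hx =>
    obtain ⟨m, rfl⟩ := hx
    induction m using BalTensor.induction_on with
    | h0 => rw [map_zero, zero_mul]; exact zero_mem _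
    | ht c s =>
      obtain ⟨m, hm⟩ := hgen (s • ψ)
      exact ⟨c • m, by rw [dualMul_smul, hm, dualMul_tmul, mul_assoc, QuadraticRing.gen_smul]⟩
    | ha x y hx hy => rw [map_add, add_mul]; exact add_mem hx hy
  | ha x y hx hy => exact add_mem hx hy

end GradedSquare

/-! ### Injectivity of `C^⊥ ⊗_K R → (gr^F A)^⊥` by means of a right action. -/

/-- The ring of additive endomorphisms of `M`, acting on the right. -/
abbrev RightEnd (M : Type*) [AddCommGroup M] : Type _ := (AddMonoid.End M)ᵐᵒᵖ

namespace RightEnd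

variable {M : Type*} [AddCommGroup M]

/-- An additive map as an element of `RightEnd M`. -/
def of (f : M →+ M) : RightEnd M := op (show AddMonoid.End M from f)

/-- The additive map which belongs to an element of `RightEnd M`. -/
def act (x : RightEnd M) : M →+ M := x.unop

theorem ext {x y : RightEnd M} (h : x.act = y.act) : x = y := unop_injective h

theorem act_of (f : M →+ M) : (of f).act = f := rfl

theorem act_one (m : M) : (1 : RightEnd M).act m = m := rfl

theorem act_zero (m : M) : (0 : RightEnd M).act m = 0 := rfl

theorem act_add (x y : RightEnd M) (m : M) : (x + y).act m = x.act m + y.act m := rfl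

theorem act_neg (x : RightEnd M) (m : M) : (-x).act m = -x.act m := rfl

theorem act_mul (x y : RightEnd M) (m : M) : (x * y).act m = y.act (x.act m) := rfl

end RightEnd

namespace GradedSquare

variable {S : GradedSquare} {hA : Function.Bijective S.mulMap} {hF : S.IsFiltered}

/-! ### The right action of `(gr^F A)^⊥` on `C^⊥ ⊗_K R` -/

variable (S) in
/-- The right multiplication by `r` on `C^⊥ ⊗_K R`. -/
def rightMul (r : S.R) : BalTensor S.K S.DualC S.R →+ BalTensor S.K S.DualC S.R :=
  BalTensor.liftFun S.K (fun c s => BalTensor.tmul S.K c (s * r))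
    (fun _ _ _ => BalTensor.add_tmul _ _ _) (fun _ _ _ => by rw [add_mul, BalTensor.tmul_add])
    (fun c k s => by rw [BalTensor.balanced, smul_R, smul_R, mul_assoc])

theorem rightMul_tmul (r s : S.R) (c : S.DualC) :
    S.rightMul r (BalTensor.tmul S.K c s) = BalTensor.tmul S.K c (s * r) := rfl

theorem rightMul_smul (r : S.R) (c : S.DualC) (m : BalTensor S.K S.DualC S.R) :
    S.rightMul r (c • m) = c • S.rightMul r m := by
  induction m using BalTensor.induction_on with
  | h0 => simp
  | ht c' s => rfl
  | ha x y hx hy => rw [smul_add, map_add, map_add, smul_add, hx, hy]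

section
variable (hP : S.IsLeftFGProjective)

variable (hA hF) in
/-- The inclusion `Hom_R(V, R) ≅ Hom_K(W, K) ⊗_K R → C^⊥ ⊗_K R`. -/
def dualToTensor (hP : S.IsLeftFGProjective) :
    LeftDual S.R (S.filteredRing hA hF).Gen →+ BalTensor S.K S.DualC S.R :=
  (BalTensor.liftFun S.K (fun φ r => BalTensor.tmul S.K (S.dualCGen φ) r)
    (fun _ _ _ => by rw [map_add, BalTensor.add_tmul]) (fun _ _ _ => BalTensor.tmul_add _ _ _)
    (fun φ k r => by
      rw [QuadraticRing.gen_op_smul, ← QuadraticRing.op_smul_def, BalTensor.balanced])).comp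
  (AddEquiv.ofBijective _ (tensorDual_bijective hP)).symm.toAddMonoidHom

theorem dualToTensor_op_smul_extendDual (φ : LeftDual S.K S.W) (r : S.R) :
    dualToTensor hA hF hP (op r • S.extendDual hA hF φ) =
      BalTensor.tmul S.K (S.dualCGen φ) r := by
  have h : (AddEquiv.ofBijective _ (tensorDual_bijective (hA := hA) (hF := hF) hP)).symm
      (op r • S.extendDual hA hF φ) = BalTensor.tmul S.K φ r := by
    rw [AddEquiv.symm_apply_eq]; rfl
  rw [dualToTensor, AddMonoidHom.comp_apply]
  exact congrArg _ h

theorem dualToTensor_extendDual (φ : LeftDual S.K S.W) :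
    dualToTensor hA hF hP (S.extendDual hA hF φ) = BalTensor.tmul S.K (S.dualCGen φ) 1 := by
  rw [← dualToTensor_op_smul_extendDual hP, op_one, one_smul]

theorem dualToTensor_op_smul (r : S.R) (ψ : LeftDual S.R (S.filteredRing hA hF).Gen) :
    dualToTensor hA hF hP (op r • ψ) = S.rightMul r (dualToTensor hA hF hP ψ) := by
  induction ψ using induction_leftDual hP with
  | ht φ s =>
    rw [← mul_smul, ← op_mul, dualToTensor_op_smul_extendDual, dualToTensor_op_smul_extendDual,
      rightMul_tmul]
  | ha x y hx hy => rw [smul_add, map_add, map_add, map_add, hx, hy]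

/-- Left linearity over `K` is what makes `(c, s) ↦ c·(sψ)` balanced in `rightMulDual`. -/
theorem dualToTensor_smul (k : S.K) (ψ : LeftDual S.R (S.filteredRing hA hF).Gen) :
    dualToTensor hA hF hP (S.etaR k • ψ) = S.dualCBase k • dualToTensor hA hF hP ψ := by
  induction ψ using induction_leftDual hP with
  | ht φ s =>
    rw [smul_comm, ← extendDual_smul, dualToTensor_op_smul_extendDual,
      dualToTensor_op_smul_extendDual, BalTensor.smul_tmul, QuadraticRing.gen_smul, smul_eq_mul]
  | ha x y hx hy => rw [smul_add, map_add, map_add, smul_add, hx, hy]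

/-- The right multiplication by `ψ` on `C^⊥ ⊗_K R`. -/
def rightMulDual (ψ : LeftDual S.R (S.filteredRing hA hF).Gen) :
    BalTensor S.K S.DualC S.R →+ BalTensor S.K S.DualC S.R :=
  BalTensor.liftFun S.K (fun c s => c • dualToTensor hA hF hP (s • ψ))
    (fun c c' s => add_smul c c' _) (fun _ _ _ => by rw [add_smul, map_add, smul_add])
    (fun c k s => by
      rw [QuadraticRing.op_smul_def, smul_R, mul_smul (S.etaR k), dualToTensor_smul, smul_smul])

theorem rightMulDual_tmul (ψ : LeftDual S.R (S.filteredRing hA hF).Gen) (c : S.DualC) (s : S.R) :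
    rightMulDual hP ψ (BalTensor.tmul S.K c s) = c • dualToTensor hA hF hP (s • ψ) := rfl

theorem rightMulDual_smul (ψ : LeftDual S.R (S.filteredRing hA hF).Gen) (c : S.DualC)
    (m : BalTensor S.K S.DualC S.R) : rightMulDual hP ψ (c • m) = c • rightMulDual hP ψ m := by
  induction m using BalTensor.induction_on with
  | h0 => simp
  | ht c' s => exact mul_smul c c' (dualToTensor hA hF hP (s • ψ))
  | ha x y hx hy => rw [smul_add, map_add, map_add, smul_add, hx, hy]

variable (S) in
/-- The right multiplication by elements of `R` as a ring homomorphism. -/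
def rightMulHom : S.R →+* RightEnd (BalTensor S.K S.DualC S.R) where
  toFun r := RightEnd.of (S.rightMul r)
  map_one' := RightEnd.ext (BalTensor.hom_ext fun c s => by
    rw [RightEnd.act_of, rightMul_tmul, mul_one, RightEnd.act_one])
  map_mul' r r' := RightEnd.ext (BalTensor.hom_ext fun c s => by
    rw [RightEnd.act_mul, RightEnd.act_of, RightEnd.act_of, RightEnd.act_of, rightMul_tmul,
      rightMul_tmul, rightMul_tmul, mul_assoc])
  map_zero' := RightEnd.ext (BalTensor.hom_ext fun c s => by
    rw [RightEnd.act_of, rightMul_tmul, mul_zero, RightEnd.act_zero]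
    exact map_zero (BalTensor.tmulRight S.K c))
  map_add' r r' := RightEnd.ext (BalTensor.hom_ext fun c s => by
    rw [RightEnd.act_add, RightEnd.act_of, RightEnd.act_of, RightEnd.act_of, rightMul_tmul,
      rightMul_tmul, rightMul_tmul, mul_add, BalTensor.tmul_add])

@[simp] theorem act_rightMulHom (r : S.R) : (S.rightMulHom r).act = S.rightMul r := rfl

/-- The right multiplication by elements of `Hom_R(V, R)` as an additive map. -/
def rightMulDualHom : LeftDual S.R (S.filteredRing hA hF).Gen →+
    RightEnd (BalTensor S.K S.DualC S.R) :=
  AddMonoidHom.mk' (fun ψ => RightEnd.of (rightMulDual hP ψ)) fun ψ ψ' =>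
    RightEnd.ext (BalTensor.hom_ext fun c s => by
      change c • dualToTensor hA hF hP (s • (ψ + ψ')) =
        c • dualToTensor hA hF hP (s • ψ) + c • dualToTensor hA hF hP (s • ψ')
      rw [smul_add, map_add, smul_add])

@[simp] theorem act_rightMulDualHom (ψ : LeftDual S.R (S.filteredRing hA hF).Gen) :
    (rightMulDualHom hP ψ).act = rightMulDual hP ψ := rfl

theorem rightMulDualHom_smul (r : S.R) (ψ : LeftDual S.R (S.filteredRing hA hF).Gen) :
    rightMulDualHom hP (r • ψ) = S.rightMulHom r * rightMulDualHom hP ψ :=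
  RightEnd.ext (BalTensor.hom_ext fun c s => by
    rw [RightEnd.act_mul, act_rightMulHom, act_rightMulDualHom, act_rightMulDualHom, rightMul_tmul,
      rightMulDual_tmul, rightMulDual_tmul, mul_smul])

theorem rightMulDualHom_op_smul (r : S.R) (ψ : LeftDual S.R (S.filteredRing hA hF).Gen) :
    rightMulDualHom hP (op r • ψ) = rightMulDualHom hP ψ * S.rightMulHom r :=
  RightEnd.ext (BalTensor.hom_ext fun c s => by
    rw [RightEnd.act_mul, act_rightMulHom, act_rightMulDualHom, act_rightMulDualHom,
      rightMulDual_tmul, rightMulDual_tmul, smul_comm, dualToTensor_op_smul, rightMul_smul])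

/-- The right multiplication by elements of `Hom_R(V, R) ⊗_R Hom_R(V, R)`. -/
def rightMulDual₂ : BalTensor S.R (LeftDual S.R (S.filteredRing hA hF).Gen)
    (LeftDual S.R (S.filteredRing hA hF).Gen) →+
      RightEnd (BalTensor S.K S.DualC S.R) :=
  BalTensor.liftFun S.R (fun ψ ψ' => rightMulDualHom hP ψ * rightMulDualHom hP ψ')
    (fun _ _ _ => by rw [map_add, add_mul]) (fun _ _ _ => by rw [map_add, mul_add])
    (fun ψ r ψ' => by rw [rightMulDualHom_op_smul, rightMulDualHom_smul, mul_assoc])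

theorem act_rightMulDual₂_tmul (ψ ψ' : LeftDual S.R (S.filteredRing hA hF).Gen)
    (m : BalTensor S.K S.DualC S.R) :
    (rightMulDual₂ hP (BalTensor.tmul S.R ψ ψ')).act m =
      rightMulDual hP ψ' (rightMulDual hP ψ m) := rfl

/-- Reduces the action on all of `C^⊥ ⊗_K R` to the action on `1 ⊗ 1`, at the price of replacing `t`
by `st`. -/
theorem act_rightMulDual₂_apply
    (t : BalTensor S.R (LeftDual S.R (S.filteredRing hA hF).Gen)
      (LeftDual S.R (S.filteredRing hA hF).Gen)) (c : S.DualC) (s : S.R) :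
    (rightMulDual₂ hP t).act (BalTensor.tmul S.K c s) =
      c • (rightMulDual₂ hP (s • t)).act (BalTensor.tmul S.K 1 1) := by
  induction t using BalTensor.induction_on with
  | h0 => rw [smul_zero, map_zero]; exact (smul_zero c).symm
  | ht ψ ψ' =>
    rw [BalTensor.smul_tmul, act_rightMulDual₂_tmul, act_rightMulDual₂_tmul, rightMulDual_tmul,
      rightMulDual_smul, rightMulDual_tmul, one_smul, one_smul]
  | ha x y hx hy =>
    rw [smul_add, map_add, map_add, RightEnd.act_add, RightEnd.act_add, smul_add, hx, hy]

theorem act_rightMulDual₂_extendDual₂ (r : S.R)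
    (t : BalTensor S.K (LeftDual S.K S.W) (LeftDual S.K S.W)) :
    (rightMulDual₂ hP (extendDual₂ hA hF r t)).act (BalTensor.tmul S.K 1 1) =
      BalTensor.tmul S.K (QuadraticRing.gen₂ _ _ (LeftDual.annihilator S.relationsC) t) r := by
  induction t using BalTensor.induction_on with
  | h0 =>
    rw [map_zero, map_zero, map_zero]
    exact (map_zero (BalTensor.tmulLeft S.K r)).symm
  | ht φ φ' =>
    rw [extendDual₂_tmul, act_rightMulDual₂_tmul, rightMulDual_tmul, one_smul, one_smul,
      dualToTensor_extendDual, rightMulDual_tmul, one_smul, dualToTensor_op_smul_extendDual,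
      QuadraticRing.gen₂_tmul]
    rfl
  | ha x y hx hy =>
    rw [map_add, map_add, map_add, RightEnd.act_add, BalTensor.add_tmul, hx, hy]

/-- On `1 ⊗ 1` the generators `t'r` of `I_A^⊥`, with `t'` in `I_C^⊥`, act by the class of `t'` in
`C^⊥`, which is zero. The general case follows since `I_A^⊥` is stable under the left action of `R`;
this is where the left augmentation enters. -/
theorem rightMulDual₂_eq_zero (hC : S.IsHomogeneousQuadratic)
    {t : BalTensor S.R (LeftDual S.R (S.filteredRing hA hF).Gen)
      (LeftDual S.R (S.filteredRing hA hF).Gen)}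
    (ht : t ∈ (S.filteredRing hA hF).dualRelations) : rightMulDual₂ hP t = 0 := by
  have key : ∀ t ∈ (S.filteredRing hA hF).dualRelations,
      (rightMulDual₂ hP t).act (BalTensor.tmul S.K 1 1) = 0 := fun t ht => by
    refine AddSubgroup.closure_induction
      (p := fun t _ => (rightMulDual₂ hP t).act (BalTensor.tmul S.K 1 1) = 0) ?_ ?_ ?_ ?_
      (mem_closure_of_mem_dualRelations hC hP ht)
    · rintro _ ⟨r, t, ht, rfl⟩
      rw [act_rightMulDual₂_extendDual₂, QuadraticRing.gen₂_eq_zero ht]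
      exact map_zero (BalTensor.tmulLeft S.K r)
    · rw [map_zero]; rfl
    · intro x y _ _ hx hy
      rw [map_add, RightEnd.act_add, hx, hy, add_zero]
    · intro x _ hx
      rw [map_neg, RightEnd.act_neg, hx, neg_zero]
  refine RightEnd.ext (BalTensor.hom_ext fun c s => ?_)
  rw [act_rightMulDual₂_apply, key _ (LeftDual.smul_mem_annihilator
    (fun z hz => SplitFilteredRing.translate_mem_relations isLeftAugmentation s hz) ht), smul_zero,
    RightEnd.act_zero]

variable (hA hF) in
/-- The right action of `(gr^F A)^⊥` on `C^⊥ ⊗_K R`. -/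
def rightAction (hC : S.IsHomogeneousQuadratic) (hP : S.IsLeftFGProjective) :
    (S.filteredRing hA hF).Dual →+* RightEnd (BalTensor S.K S.DualC S.R) :=
  QuadraticRing.lift S.rightMulHom (rightMulDualHom hP) (rightMulDualHom_smul hP)
    (rightMulDualHom_op_smul hP) (rightMulDual₂ hP) (fun _ _ => rfl)
    (fun _ ht => rightMulDual₂_eq_zero hP hC ht)

theorem rightAction_base (hC : S.IsHomogeneousQuadratic) (r : S.R) :
    rightAction hA hF hC hP ((S.filteredRing hA hF).dualBase r) = S.rightMulHom r :=
  QuadraticRing.lift_base (B := RightEnd (BalTensor S.K S.DualC S.R)) _ _ _ _ _ _ _ r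

theorem rightAction_gen (hC : S.IsHomogeneousQuadratic)
    (ψ : LeftDual S.R (S.filteredRing hA hF).Gen) :
    rightAction hA hF hC hP ((S.filteredRing hA hF).dualGen ψ) = rightMulDualHom hP ψ :=
  QuadraticRing.lift_gen (B := RightEnd (BalTensor S.K S.DualC S.R)) _ _ _ _ _ _ _ ψ

theorem rightAction_dualHom (hC : S.IsHomogeneousQuadratic) (c c' : S.DualC) :
    (rightAction hA hF hC hP (dualHom hA hF hC c)).act (BalTensor.tmul S.K c' 1) =
      BalTensor.tmul S.K (c' * c) 1 := by
  induction c using QuadraticRing.induction_on generalizing c' with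
  | hb k =>
    rw [dualHom_base, rightAction_base, act_rightMulHom, rightMul_tmul, one_mul,
      ← QuadraticRing.op_smul_def, BalTensor.balanced, smul_R, mul_one]
  | hg φ =>
    rw [dualHom_gen, rightAction_gen, act_rightMulDualHom, rightMulDual_tmul, one_smul,
      dualToTensor_extendDual, BalTensor.smul_tmul, smul_eq_mul]
  | ha x y hx hy =>
    rw [map_add, map_add, RightEnd.act_add, hx, hy, mul_add, BalTensor.add_tmul]
  | hm x y hx hy =>
    rw [map_mul, map_mul, RightEnd.act_mul, hx, hy, mul_assoc]

/-- The action on `1 ⊗ 1` is a left inverse: `cr` sends it to `c ⊗ 1` and then to `c ⊗ r`. -/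
theorem dualMul_injective (hC : S.IsHomogeneousQuadratic) (hP : S.IsLeftFGProjective) :
    Function.Injective (dualMul hA hF hC) := by
  have h : ∀ m, (rightAction hA hF hC hP (dualMul hA hF hC m)).act (BalTensor.tmul S.K 1 1) =
      m := fun m => by
    induction m using BalTensor.induction_on with
    | h0 => rw [map_zero, map_zero, RightEnd.act_zero]
    | ht c r =>
      rw [dualMul_tmul, map_mul, RightEnd.act_mul, rightAction_dualHom,
        rightAction_base, act_rightMulHom, rightMul_tmul, one_mul, one_mul]
    | ha x y hx hy => rw [map_add, map_add, RightEnd.act_add, hx, hy]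
  intro m m' hm
  rw [← h m, hm, h]

end

end GradedSquare

/-! ### Differentials on quadratic rings: degree and uniqueness. -/

/-- An odd derivation of degree one of a quadratic ring preserves the grading if it does so on
generators. -/
theorem QuadraticRing.map_mem_grade {R V : Type*} [Ring R] [AddCommGroup V] [Module R V]
    [Module Rᵐᵒᵖ V] {I : AddSubgroup (BalTensor R V V)}
    {d : QuadraticRing R V I →+ QuadraticRing R V I}
    (hd : ∀ a b, d (a * b) = d a * b + sign R V I a * d b)
    (hb : ∀ r, d (base R V I r) ∈ grade R V I 1) (hg : ∀ v, d (gen R V I v) ∈ grade R V I 2)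
    {n : ℕ} {b : QuadraticRing R V I} (h : b ∈ grade R V I n) : d b ∈ grade R V I (n + 1) := by
  induction n generalizing b with
  | zero => obtain ⟨r, rfl⟩ := h; exact hb r
  | succ n ih =>
    refine AddSubgroup.closure_induction (p := fun b _ => d b ∈ grade R V I (n + 1 + 1))
      ?_ ?_ ?_ ?_ h
    · rintro _ ⟨v, b, hb', rfl⟩
      rw [hd, sign_gen, neg_mul]
      refine add_mem ?_ (neg_mem ?_)
      · have := mul_mem_grade (hg v) hb'
        rwa [add_comm 2 n] at this
      · have := mul_mem_grade (gen_mem_grade v) (ih hb')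
        rwa [add_comm 1 (n + 1)] at this
    · rw [map_zero]; exact zero_mem _
    · intro x y _ _ hx hy; rw [map_add]; exact add_mem hx hy
    · intro x _ hx; rw [map_neg]; exact neg_mem hx

/-- A differential of a quadratic ring is determined by its values on generators. -/
theorem QuadraticRing.differential_ext {R V : Type*} [Ring R] [AddCommGroup V] [Module R V]
    [Module Rᵐᵒᵖ V] {I : AddSubgroup (BalTensor R V V)}
    {d d' : QuadraticRing R V I →+ QuadraticRing R V I}
    (hd : IsDGRing (grade R V I) d) (hd' : IsDGRing (grade R V I) d')
    (hb : ∀ r, d (base R V I r) = d' (base R V I r))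
    (hg : ∀ v, d (gen R V I v) = d' (gen R V I v)) : d = d' := by
  have h : ∀ n, ∀ b ∈ grade R V I n, d b = d' b := by
    intro n
    induction n with
    | zero => rintro _ ⟨r, rfl⟩; exact hb r
    | succ n ih =>
      intro b hb'
      refine AddSubgroup.closure_induction (p := fun b _ => d b = d' b) ?_ ?_ ?_ ?_ hb'
      · rintro _ ⟨v, b, hb', rfl⟩
        rw [hd.leibniz 1 _ (gen_mem_grade v), hd'.leibniz 1 _ (gen_mem_grade v), hg, ih b hb']
      · rw [map_zero, map_zero]
      · intro x y _ _ hx hy; rw [map_add, map_add, hx, hy]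
      · intro x _ hx; rw [map_neg, map_neg, hx]
  refine AddMonoidHom.ext fun b => ?_
  obtain ⟨x, rfl⟩ := isInternal_grade.2 b
  induction x using DirectSum.induction_on with
  | zero => simp
  | of n b => rw [DirectSum.coeAddMonoidHom_of]; exact h n _ b.2
  | add x y hx hy => rw [map_add, map_add, map_add, hx, hy]

/-- Positselski's differential is unique. -/
theorem SplitFilteredRing.IsPositselskiDifferential.unique {R A : Type*} [Ring R] [Ring A]
    {T : SplitFilteredRing R A} (s : T.Section) {d d' : T.Dual →+ T.Dual}
    (hd : T.IsPositselskiDifferential d) (hd' : T.IsPositselskiDifferential d') : d = d' := by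
  refine QuadraticRing.differential_ext hd.isDGRing hd'.isDGRing (fun r => ?_) (fun φ => ?_)
  · obtain ⟨α, hα, hα'⟩ := hd.base r
    obtain ⟨β, hβ, hβ'⟩ := hd'.base r
    exact hα.trans ((congrArg T.dualGen (LeftDual.ext fun v =>
      (hα' v).trans (hβ' v).symm)).trans hβ.symm)
  · exact pairsTo_unique (hd.gen s φ) (hd'.gen s φ)

/-! ### Construction of the differential, Leibniz rule and square zero. -/

namespace GradedSquare

variable {S : GradedSquare} {hA : Function.Bijective S.mulMap} {hF : S.IsFiltered}

/-! ### The differential -/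

/-- Because `wk` lies in `W`, it has no component in `R`. -/
theorem qhat_etaR (k : S.K) : (S.filteredRing hA hF).qhat (S.etaR k) = 0 :=
  leftDual_ext fun w => by
    change S.extend hA S.epsC (S.kappa w.val * S.iota (S.etaR k)) = 0
    have h := extend_mul_kappa hA S.epsC 1 (W.val (op k • w))
    rwa [epsC_val, map_zero, mul_zero, map_one, one_mul, W.val_op_smul, map_mul, ← S.comm] at h

/-- The `K`-linearity which makes `c ⊗ r ↦ ± c q̂(r)` well defined on `C^⊥ ⊗_K R`. -/
theorem qhat_etaR_mul (k : S.K) (r : S.R) : (S.filteredRing hA hF).qhat (S.etaR k * r) =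
    S.etaR k • (S.filteredRing hA hF).qhat r := by
  rw [SplitFilteredRing.qhat_mul, qhat_etaR, smul_zero, zero_add]

/-- The defining function of the differential vanishes on `Hom_K(W, K)`. -/
theorem differentialForm_extendDual (φ : LeftDual S.K S.W)
    (t : (S.filteredRing hA hF).liftedRelations) :
    (S.filteredRing hA hF).differentialForm (S.extendDual hA hF φ) t = 0 := by
  -- The key identity for `θ = φ ∘ projW`; for `a` in `V` its right side is the value of `q` which
  -- occurs in `q̃`.
  have h₁ : ∀ (a : S.A) (v : (S.filteredRing hA hF).Gen),
      S.extend hA (LinearMap.comp φ S.projW) (a * v.val) =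
        S.extend hA S.epsC (a * S.iota (S.extendDual hA hF φ v)) := fun a v => by
    induction v using induction_Gen with
    | ht r w =>
      have hw : φ (S.projW w.val) = φ w := by rw [projW_val]
      have h := extend_mul_kappa_of_mul hA (LinearMap.comp φ S.projW) w.val (fun c => by
        change φ (S.projW (c * w.val)) = S.epsC c * φ (S.projW w.val)
        rw [projW_mul_val, LeftDual.map_smul, hw]) (a * S.iota r)
      change _ = S.extend hA S.epsC (a * S.iota r * S.iota (S.etaR (φ (S.projW w.val)))) at h
      rw [hw, mul_assoc, mul_assoc, ← map_mul] at h
      rw [extendDual_smul_inclW]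
      exact h
    | ha x y hx hy =>
      rw [map_add, mul_add, map_add, hx, hy, map_add, map_add, mul_add, map_add]
  have h₂ : ∀ t, S.extend hA (LinearMap.comp φ S.projW) ((S.filteredRing hA hF).mu t) =
      (S.filteredRing hA hF).qtilde (S.extendDual hA hF φ) t := fun t => by
    induction t with
    | zero => simp
    | tmul v w => exact h₁ v.val w
    | add x y hx hy => rw [map_add, map_add, map_add, hx, hy]
  -- Without curvature, `p t` and the product of `t` agree in `A`.
  rw [SplitFilteredRing.differentialForm, ← h₂, sub_eq_zero,
    ← SplitFilteredRing.val_p isLeftAugmentation]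
  rfl

variable (hC : S.IsHomogeneousQuadratic) (hP : S.IsLeftFGProjective)

variable (hA hF) in
/-- The differential on `(gr^F A)^⊥ ≅ C^⊥ ⊗_K R`: it sends `c r`, for `c` of degree `n`, to
`(-1)ⁿ c q̂(r)`. -/
def differential : (S.filteredRing hA hF).Dual →+ (S.filteredRing hA hF).Dual :=
  (BalTensor.liftFun S.K (fun c r => dualHom hA hF hC (QuadraticRing.sign _ _ _ c) *
      (S.filteredRing hA hF).dualGen ((S.filteredRing hA hF).qhat r))
    (fun _ _ _ => by rw [map_add, map_add, add_mul])
    (fun _ _ _ => by rw [SplitFilteredRing.qhat_add, map_add, mul_add])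
    (fun c k r => by
      rw [QuadraticRing.op_smul_def, map_mul, QuadraticRing.sign_base, map_mul, dualHom_base,
        smul_R, qhat_etaR_mul, QuadraticRing.gen_smul, mul_assoc])).comp
  (AddEquiv.ofBijective _ ⟨dualMul_injective hC hP, dualMul_surjective hC hP⟩).symm.toAddMonoidHom

theorem differential_dualMul_tmul (c : S.DualC) (r : S.R) :
    differential hA hF hC hP (dualHom hA hF hC c * (S.filteredRing hA hF).dualBase r) =
      dualHom hA hF hC (QuadraticRing.sign _ _ _ c) *
        (S.filteredRing hA hF).dualGen ((S.filteredRing hA hF).qhat r) := by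
  have h : (AddEquiv.ofBijective (dualMul hA hF hC)
      ⟨dualMul_injective hC hP, dualMul_surjective hC hP⟩).symm
        (dualHom hA hF hC c * (S.filteredRing hA hF).dualBase r) = BalTensor.tmul S.K c r := by
    rw [AddEquiv.symm_apply_eq]; rfl
  rw [differential, AddMonoidHom.comp_apply]
  exact congrArg _ h

theorem differential_base (r : S.R) :
    differential hA hF hC hP ((S.filteredRing hA hF).dualBase r) =
      (S.filteredRing hA hF).dualGen ((S.filteredRing hA hF).qhat r) := by
  have h := differential_dualMul_tmul (hA := hA) (hF := hF) hC hP 1 r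
  rwa [map_one, map_one, map_one, one_mul, one_mul] at h

theorem differential_gen_op_smul (φ : LeftDual S.K S.W) (r : S.R) :
    differential hA hF hC hP
        ((S.filteredRing hA hF).dualGen (op r • S.extendDual hA hF φ)) =
      -((S.filteredRing hA hF).dualGen (S.extendDual hA hF φ) *
        (S.filteredRing hA hF).dualGen ((S.filteredRing hA hF).qhat r)) := by
  rw [QuadraticRing.gen_op_smul, ← dualHom_gen hC, differential_dualMul_tmul,
    QuadraticRing.sign_gen, map_neg, neg_mul]

theorem differential_gen_extendDual (φ : LeftDual S.K S.W) :
    differential hA hF hC hP ((S.filteredRing hA hF).dualGen (S.extendDual hA hF φ)) = 0 := by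
  have h := differential_gen_op_smul (hA := hA) (hF := hF) hC hP φ 1
  rwa [op_one, one_smul, SplitFilteredRing.qhat_one, map_zero, mul_zero, neg_zero] at h

/-- Induction over the products `c r` which generate `(gr^F A)^⊥`. -/
theorem induction_dual (hC : S.IsHomogeneousQuadratic) (hP : S.IsLeftFGProjective)
    {p : (S.filteredRing hA hF).Dual → Prop} (b : (S.filteredRing hA hF).Dual)
    (ht : ∀ c r, p (dualHom hA hF hC c * (S.filteredRing hA hF).dualBase r))
    (ha : ∀ x y, p x → p y → p (x + y)) : p b := by
  obtain ⟨t, rfl⟩ := dualMul_surjective hC hP b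
  induction t using BalTensor.induction_on with
  | h0 => simpa using ht 0 0
  | ht c r => exact ht c r
  | ha x y hx hy => rw [map_add]; exact ha _ _ hx hy

theorem differential_dualHom_mul (c : S.DualC) (b : (S.filteredRing hA hF).Dual) :
    differential hA hF hC hP (dualHom hA hF hC c * b) =
      dualHom hA hF hC (QuadraticRing.sign _ _ _ c) * differential hA hF hC hP b := by
  induction b using induction_dual hC hP with
  | ht c' r =>
    rw [← mul_assoc, ← map_mul, differential_dualMul_tmul, differential_dualMul_tmul, map_mul,
      map_mul, mul_assoc]
  | ha x y hx hy => rw [mul_add, map_add, map_add, mul_add, hx, hy]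

/-- The differential of `ψ` is represented by an element with the prescribed pairing. -/
theorem exists_differential_gen (ψ : LeftDual S.R (S.filteredRing hA hF).Gen) :
    ∃ t, QuadraticRing.gen₂ _ _ (S.filteredRing hA hF).dualRelations t =
        differential hA hF hC hP ((S.filteredRing hA hF).dualGen ψ) ∧
      ∀ i : (S.filteredRing hA hF).liftedRelations,
        LeftDual.pairing t (BalTensor.proj S.R i.1) =
          (S.filteredRing hA hF).differentialForm ψ i := by
  induction ψ using induction_leftDual hP with
  | ht φ r =>
    -- The representative is dictated by `d(φr) = -φ q̂(r)`; the product rule of the form, with zero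
    -- form for `φ`, gives the same pairing.
    refine ⟨-BalTensor.tmul S.R (S.extendDual hA hF φ) ((S.filteredRing hA hF).qhat r), ?_,
      fun i => ?_⟩
    · rw [differential_gen_op_smul, map_neg, QuadraticRing.gen₂_tmul]
    · rw [SplitFilteredRing.differentialForm_op_smul, differentialForm_extendDual, zero_mul,
        zero_sub, map_neg]; rfl
  | ha x y hx hy =>
    obtain ⟨s, hs, hs'⟩ := hx
    obtain ⟨t, ht, ht'⟩ := hy
    refine ⟨s + t, by rw [map_add, map_add, map_add, hs, ht], fun i => ?_⟩
    rw [map_add, AddMonoidHom.add_apply, hs', ht', SplitFilteredRing.differentialForm_add]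

/-- Computes `dψ` from its form alone, without writing `ψ` as a sum of products `φr`. -/
theorem differential_gen_eq (ψ : LeftDual S.R (S.filteredRing hA hF).Gen)
    (t : BalTensor S.R (LeftDual S.R (S.filteredRing hA hF).Gen)
      (LeftDual S.R (S.filteredRing hA hF).Gen))
    (ht : ∀ i : (S.filteredRing hA hF).liftedRelations,
      LeftDual.pairing t (BalTensor.proj S.R i.1) =
        (S.filteredRing hA hF).differentialForm ψ i) :
    differential hA hF hC hP ((S.filteredRing hA hF).dualGen ψ) =
      QuadraticRing.gen₂ _ _ (S.filteredRing hA hF).dualRelations t := by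
  obtain ⟨t', h, h'⟩ := exists_differential_gen hC hP ψ
  rw [← h]
  refine SplitFilteredRing.gen₂_eq_of_pairing fun i hi => ?_
  obtain ⟨i, rfl⟩ := BalTensor.proj_surjective S.R i
  exact (h' ⟨i, hi⟩).trans (ht ⟨i, hi⟩).symm

/-- The one case of the Leibniz rule which the definition does not display: in `rφ` the scalar is on
the wrong side. It comes from the product rule of the form for the left action. -/
theorem differential_gen_smul_extendDual (r : S.R) (φ : LeftDual S.K S.W) :
    differential hA hF hC hP ((S.filteredRing hA hF).dualGen (r • S.extendDual hA hF φ)) =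
      (S.filteredRing hA hF).dualGen ((S.filteredRing hA hF).qhat r) *
        (S.filteredRing hA hF).dualGen (S.extendDual hA hF φ) := by
  rw [← QuadraticRing.gen₂_tmul]
  refine differential_gen_eq hC hP _ _ fun i => ?_
  rw [SplitFilteredRing.differentialForm_smul isLeftAugmentation, differentialForm_extendDual,
    zero_add]

theorem differential_gen_qhat (r : S.R) : differential hA hF hC hP
    ((S.filteredRing hA hF).dualGen ((S.filteredRing hA hF).qhat r)) = 0 := by
  rw [differential_gen_eq hC hP _ 0 fun i => ?_, map_zero]
  rw [SplitFilteredRing.differentialForm_qhat isLeftAugmentation, map_zero]; rfl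

/-- The elements `b` which satisfy the rule against every `a` are closed under sums and products, so
`b` in `R` or in `Hom_K(W, K)` suffices. With `a = cr`, the first case is the Leibniz rule of `q̂`
and the second is the formula for `d(rφ)`. -/
theorem differential_mul (a b : (S.filteredRing hA hF).Dual) :
    differential hA hF hC hP (a * b) = differential hA hF hC hP a * b +
      QuadraticRing.sign _ _ _ a * differential hA hF hC hP b := by
  have hbase : ∀ a s, differential hA hF hC hP (a * (S.filteredRing hA hF).dualBase s) =
      differential hA hF hC hP a * (S.filteredRing hA hF).dualBase s +
      QuadraticRing.sign _ _ _ a *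
        differential hA hF hC hP ((S.filteredRing hA hF).dualBase s) := fun a s => by
    induction a using induction_dual hC hP with
    | ht c r =>
      rw [mul_assoc, ← map_mul, differential_dualMul_tmul, differential_dualMul_tmul,
        SplitFilteredRing.qhat_mul, map_add, mul_add, QuadraticRing.gen_op_smul,
        QuadraticRing.gen_smul, differential_base, map_mul, QuadraticRing.sign_base, dualHom_sign,
        mul_assoc, mul_assoc]
    | ha x y hx hy => rw [add_mul, map_add, map_add, map_add, hx, hy]; noncomm_ring
  have hgen : ∀ a φ,
      differential hA hF hC hP (a * (S.filteredRing hA hF).dualGen (S.extendDual hA hF φ)) =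
      differential hA hF hC hP a * (S.filteredRing hA hF).dualGen (S.extendDual hA hF φ) +
      QuadraticRing.sign _ _ _ a * differential hA hF hC hP
        ((S.filteredRing hA hF).dualGen (S.extendDual hA hF φ)) := fun a φ => by
    induction a using induction_dual hC hP with
    | ht c r =>
      rw [mul_assoc, ← QuadraticRing.gen_smul, differential_dualHom_mul,
        differential_gen_smul_extendDual, differential_dualMul_tmul, differential_gen_extendDual,
        mul_zero, add_zero, mul_assoc]
    | ha x y hx hy => rw [add_mul, map_add, map_add, map_add, hx, hy]; noncomm_ring
  have hmul : ∀ b b', (∀ a, differential hA hF hC hP (a * b) = differential hA hF hC hP a * b +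
      QuadraticRing.sign _ _ _ a * differential hA hF hC hP b) →
      (∀ a, differential hA hF hC hP (a * b') = differential hA hF hC hP a * b' +
      QuadraticRing.sign _ _ _ a * differential hA hF hC hP b') →
      ∀ a, differential hA hF hC hP (a * (b * b')) = differential hA hF hC hP a * (b * b') +
      QuadraticRing.sign _ _ _ a * differential hA hF hC hP (b * b') := fun b b' hb hb' a => by
    rw [← mul_assoc, hb', hb, hb', map_mul]; noncomm_ring
  have hadd : ∀ b b', (∀ a, differential hA hF hC hP (a * b) = differential hA hF hC hP a * b +
      QuadraticRing.sign _ _ _ a * differential hA hF hC hP b) →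
      (∀ a, differential hA hF hC hP (a * b') = differential hA hF hC hP a * b' +
      QuadraticRing.sign _ _ _ a * differential hA hF hC hP b') →
      ∀ a, differential hA hF hC hP (a * (b + b')) = differential hA hF hC hP a * (b + b') +
      QuadraticRing.sign _ _ _ a * differential hA hF hC hP (b + b') := fun b b' hb hb' a => by
    rw [mul_add, map_add, map_add, hb, hb']; noncomm_ring
  induction b using QuadraticRing.induction_on generalizing a with
  | hb r => exact hbase a r
  | hg ψ =>
    induction ψ using induction_leftDual hP generalizing a with
    | ht φ r =>
      rw [QuadraticRing.gen_op_smul]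
      exact hmul _ _ (fun a => hgen a φ) (fun a => hbase a r) a
    | ha x y hx hy => rw [map_add]; exact hadd _ _ hx hy a
  | ha x y hx hy => exact hadd _ _ hx hy a
  | hm x y hx hy => exact hmul _ _ hx hy a

/-- The factor from `C^⊥` passes through `d` up to sign, so only `d(q̂(r)) = 0` is needed. -/
theorem differential_differential (b : (S.filteredRing hA hF).Dual) :
    differential hA hF hC hP (differential hA hF hC hP b) = 0 := by
  induction b using induction_dual hC hP with
  | ht c r =>
    rw [differential_dualMul_tmul, differential_dualHom_mul, differential_gen_qhat, mul_zero]
  | ha x y hx hy => rw [map_add, map_add, hx, hy, add_zero]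

theorem isDGRing_differential :
    IsDGRing (S.filteredRing hA hF).dualGrade (differential hA hF hC hP) where
  gradedMonoid := QuadraticRing.gradedMonoid_grade
  isInternal := QuadraticRing.isInternal_grade
  map_mem n b hb := by
    refine QuadraticRing.map_mem_grade (differential_mul hC hP) (fun r => ?_) (fun ψ => ?_) hb
    · rw [differential_base]; exact QuadraticRing.gen_mem_grade _
    · obtain ⟨t, ht, -⟩ := exists_differential_gen hC hP ψ
      rw [← ht]; exact QuadraticRing.gen₂_mem_grade t
  leibniz n a ha b := by
    rw [differential_mul, QuadraticRing.sign_of_mem ha, mul_assoc]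
  sq_zero := differential_differential hC hP

theorem isPositselskiDifferential_differential :
    (S.filteredRing hA hF).IsPositselskiDifferential (differential hA hF hC hP) where
  isDGRing := isDGRing_differential hC hP
  base r := ⟨_, differential_base hC hP r, fun _ => rfl⟩
  gen s φ := by
    obtain ⟨t, ht, ht'⟩ := exists_differential_gen hC hP φ
    refine ⟨t, ht, fun i => ?_⟩
    -- The pairing is known on all of `Î`, so every section gives the same value at `i`.
    have h : BalTensor.proj S.R (s.1 i).1 = i.1 :=
      congrArg Subtype.val (LinearMap.congr_fun s.2 i)
    rw [← h]
    exact ht' (s.1 i)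

/-- `Hom_R(V, R)` is spanned by the products `φr`, on which the Leibniz rule and the two
restrictions leave no choice. -/
theorem differential_unique
    {d : (S.filteredRing hA hF).Dual →+ (S.filteredRing hA hF).Dual}
    (hd : IsDGRing (S.filteredRing hA hF).dualGrade d)
    (hb : ∀ r, d ((S.filteredRing hA hF).dualBase r) =
      (S.filteredRing hA hF).dualGen ((S.filteredRing hA hF).qhat r))
    (hg : ∀ φ, d ((S.filteredRing hA hF).dualGen (S.extendDual hA hF φ)) = 0) :
    d = differential hA hF hC hP := by
  refine QuadraticRing.differential_ext hd (isDGRing_differential hC hP)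
    (fun r => (hb r).trans (differential_base hC hP r).symm) (fun ψ => ?_)
  induction ψ using induction_leftDual hP with
  | ht φ r =>
    rw [QuadraticRing.gen_op_smul, hd.leibniz 1 _ (QuadraticRing.gen_mem_grade _),
      (isDGRing_differential hC hP).leibniz 1 _ (QuadraticRing.gen_mem_grade _)]
    erw [hb, hg]
    erw [differential_base, differential_gen_extendDual]
  | ha x y hx hy => rw [map_add, map_add, map_add, hx, hy]

end GradedSquare

theorem mainTheorem8 (S : GradedSquare)
    (hA : Function.Bijective S.mulMap)
    (hC : S.IsHomogeneousQuadratic)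
    (hF : S.IsFiltered)
    (hP : S.IsLeftFGProjective) :
    let T := S.filteredRing hA hF
    -- `A` is left augmented over `R`, and the curvature of the dual vanishes
    T.IsLeftAugmentation ∧
    (∀ t : T.liftedRelations, T.curvature t = 0) ∧
    -- `V ≅ R ⊗_K W`, and `Hom_R(V, R) ≅ Hom_K(W, K) ⊗_K R`
    (∃ e : BalTensor S.K S.R S.W ≃+ T.Gen, ∀ r w,
      (e (BalTensor.tmul S.K r w)).val = S.iota r * S.kappa w.val) ∧
    (∃ e : BalTensor S.K (LeftDual S.K S.W) S.R ≃+ LeftDual S.R T.Gen, ∀ φ r,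
      e (BalTensor.tmul S.K φ r) = op r • S.extendDual hA hF φ) ∧
    -- `R` and `Hom_R(V, R)` embed in `(gr^F A)^⊥`, and `(gr^F A)^⊥ ≅ C^⊥ ⊗_K R`
    Function.Injective T.dualBase ∧ Function.Injective T.dualGen ∧
    (∃ f : S.DualC →+* T.Dual,
      (∀ k, f (S.dualCBase k) = T.dualBase (S.etaR k)) ∧
      (∀ φ, f (S.dualCGen φ) = T.dualGen (S.extendDual hA hF φ)) ∧
      ∃ e : BalTensor S.K S.DualC S.R ≃+ T.Dual, ∀ c r,
        e (BalTensor.tmul S.K c r) = f c * T.dualBase r) ∧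
    -- Positselski's differential exists and is unique
    Nonempty T.Section ∧
    ∃ d : T.Dual →+ T.Dual,
      T.IsPositselskiDifferential d ∧
      (∀ d' : T.Dual →+ T.Dual, T.IsPositselskiDifferential d' → d' = d) ∧
      -- it is `q̂` on `R` and zero on `Hom_K(W, K)`
      (∀ r : S.R, d (T.dualBase r) = T.dualGen (T.qhat r)) ∧
      (∀ φ : LeftDual S.K S.W, d (T.dualGen (S.extendDual hA hF φ)) = 0) ∧
      -- and it is determined by these two restrictions
      (∀ d' : T.Dual →+ T.Dual, IsDGRing T.dualGrade d' →
        (∀ r : S.R, d' (T.dualBase r) = T.dualGen (T.qhat r)) →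
        (∀ φ : LeftDual S.K S.W, d' (T.dualGen (S.extendDual hA hF φ)) = 0) → d' = d) := by
  intro T
  obtain ⟨n, x, x', hx⟩ := GradedSquare.exists_dual_family hP
  have hs : Nonempty T.Section :=
    SplitFilteredRing.nonempty_section (GradedSquare.sum_extendDual_smul hx)
  exact ⟨GradedSquare.isLeftAugmentation,
    SplitFilteredRing.curvature_eq_zero GradedSquare.isLeftAugmentation,
    ⟨AddEquiv.ofBijective (GradedSquare.tensorW hA hF)
      ⟨GradedSquare.tensorW_injective, GradedSquare.tensorW_surjective⟩,
      GradedSquare.val_tensorW_tmul⟩,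
    ⟨AddEquiv.ofBijective (GradedSquare.tensorDual hA hF) (GradedSquare.tensorDual_bijective hP),
      GradedSquare.tensorDual_tmul⟩,
    QuadraticRing.base_injective, QuadraticRing.gen_injective,
    ⟨GradedSquare.dualHom hA hF hC, GradedSquare.dualHom_base hC, GradedSquare.dualHom_gen hC,
      AddEquiv.ofBijective (GradedSquare.dualMul hA hF hC)
        ⟨GradedSquare.dualMul_injective hC hP, GradedSquare.dualMul_surjective hC hP⟩,
      GradedSquare.dualMul_tmul hC⟩,
    hs, GradedSquare.differential hA hF hC hP,
    GradedSquare.isPositselskiDifferential_differential hC hP,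
    fun d' hd' => hd'.unique hs.some (GradedSquare.isPositselskiDifferential_differential hC hP),
    GradedSquare.differential_base hC hP, GradedSquare.differential_gen_extendDual hC hP,
    fun d' hd' hb hg => GradedSquare.differential_unique hC hP hd' hb hg⟩

end
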